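/- Let $n\ge 6$. An $(n-6)$-dissection of a convex regular $n$-gon is a set of $n-6$ pairwise non-crossing diagonals of the $n$-gon (so that it is partitioned into $n-5$ polygons). The number $|G(n,n-6)/Z_n|$ of orbits of the $(n-6)$-dissections of the $n$-gon under the cyclic group $Z_n$ of rotations of the $n$-gon is \[ \frac{(n-3)(n-4)^2(n-5)}{24n(2n-5)}\,C_{n-2}+\frac{(n-4)^2}{4n}\,C_{n/2-2}+\frac{n-3}{9}\,C_{n/3-1}+\frac13\,C_{n/6-1}, \] where $C_m=\frac{1}{m+1}\binom{2m}{m}$ is the $m$-th Catalan number if $m$ is a nonnegative integer, and $C_x=0$ if $x$ is a rational number that is not a nonnegative integer. -/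

import Mathlib

/-- The vertices of the `n`-gon are the elements of `Fin n`, in their cyclic order, so that
`finRotate n v` is the vertex following `v`. A diagonal is an unordered pair of distinct
vertices neither of which follows the other. -/
def IsDiagonal (n : ℕ) (e : Sym2 (Fin n)) : Prop :=
  ∃ a b : Fin n, e = s(a, b) ∧ a ≠ b ∧ finRotate n a ≠ b ∧ finRotate n b ≠ a

/-- Two chords of the convex `n`-gon cross (meet in their interiors, without being equal) iff
their endpoints are four distinct vertices that alternate along the boundary. -/
def Crosses {n : ℕ} (e f : Sym2 (Fin n)) : Prop :=
  ∃ a b c d : Fin n, a < b ∧ b < c ∧ c < d ∧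
    ((e = s(a, c) ∧ f = s(b, d)) ∨ (e = s(b, d) ∧ f = s(a, c)))

/-- The set `G(n, k)` of `k`-dissections of the `n`-gon: sets of `k` pairwise non-crossing
diagonals (which cut the `n`-gon into `k + 1` polygons). -/
def Dissection (n k : ℕ) : Type :=
  {D : Finset (Sym2 (Fin n)) //
    D.card = k ∧ (∀ e ∈ D, IsDiagonal n e) ∧ ∀ e ∈ D, ∀ f ∈ D, ¬ Crosses e f}

/-- `D` and `E` are equivalent iff some rotation of the `n`-gon, that is some power of the
rotation by one step, carries the diagonals of `D` to those of `E`. The classes are the orbits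
of the cyclic group `Z_n`. -/
def rotationSetoid (n k : ℕ) : Setoid (Dissection n k) where
  r D E := ∃ r : ℤ, E.1 = D.1.image (Sym2.map ⇑(finRotate n ^ r))
  iseqv := by
    refine ⟨fun D => ⟨0, ?_⟩, ?_, ?_⟩
    · simp
    · rintro D E ⟨r, hr⟩
      refine ⟨-r, ?_⟩
      rw [hr, Finset.image_image, ← Sym2.map_comp, ← Equiv.Perm.coe_mul, ← zpow_add]
      simp
    · rintro D E F ⟨r, hr⟩ ⟨s, hs⟩
      refine ⟨s + r, ?_⟩
      rw [hs, hr, Finset.image_image, ← Sym2.map_comp, ← Equiv.Perm.coe_mul, ← zpow_add]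

/-- The number `|G(n, k) / Z_n|` of `k`-dissections of the `n`-gon up to rotation. -/
noncomputable def numCyclicClasses (n k : ℕ) : ℕ :=
  Nat.card (Quotient (rotationSetoid n k))

/-- The Catalan number `C_x`, with the convention that `C_x = 0` unless `x` is a nonnegative
integer. -/
def catalanRat (x : ℚ) : ℚ :=
  if x.den = 1 ∧ 0 ≤ x then (catalan x.num.toNat : ℚ) else 0

/-! By Burnside's lemma, `n` times the number of orbits is the sum over `d ∣ n` of `φ(d)` times the
number of dissections invariant under rotation by `m = n / d` steps (`numCyclicClasses_mul`,
`sum_range_gcd`).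

Let `d ≥ 2`. A chord of an invariant dissection spans at most `m` steps on one side, since otherwise
it crosses its rotated copy (`IsDissection.exists_short`). Call a vertex exposed if no such short
arc passes over it. Cutting at an exposed vertex leaves a noncrossing forest of arcs on `0, …, m`,
and repeating that forest `d` times recovers the dissection (`IsDissection.unroll_windowArcs`,
`IsForest.windowArcs_unroll`). The dissection has `d` times as many exposed vertices as the forest
has uncovered ones, so counting pairs (dissection, exposed vertex), each weighted by the inverse
number of exposed vertices, gives `m` times the sum of `1 / (number of uncovered vertices)` over
forests. Diameters need care only when `d = 2`, and an even number of diagonals excludes them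
(`IsDissection.noDiameter_of_even`). The number of diagonals is otherwise a multiple of `d`; for `d
≥ 3` and `n - 6` diagonals this forces `d ∣ 6`. Only `d = 1, 2, 3, 6` survive, giving the four
terms.

For `d = 1`, dissections are forests on `0, …, n - 1` without the arc `(0, n - 1)`. All forest
counts come from one recurrence, `forestCount_succ`, whose solution is a ballot-type product
(`forestCount_formula`); the weighted sum simplifies to a product of two binomials
(`forestWeight_formula`). -/

/-! ### Noncrossing forests of arcs and their uncovered vertices -/

/-- A noncrossing set of arcs `(i, j)`, each spanning at least two steps, on the vertices
`0, …, l` of a line. -/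
def IsForest (l : ℕ) (F : Finset (ℕ × ℕ)) : Prop :=
  (∀ p ∈ F, p.1 + 2 ≤ p.2 ∧ p.2 ≤ l) ∧
    ∀ p ∈ F, ∀ q ∈ F, ¬ (p.1 < q.1 ∧ q.1 < p.2 ∧ p.2 < q.2)

/-- The vertices `v < l` lying strictly below no arc of `F`. -/
def uncovered (l : ℕ) (F : Finset (ℕ × ℕ)) : Finset ℕ :=
  (Finset.range l).filter fun v => ∀ p ∈ F, ¬ (p.1 < v ∧ v < p.2)

theorem mem_uncovered {l : ℕ} {F : Finset (ℕ × ℕ)} {v : ℕ} :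
    v ∈ uncovered l F ↔ v < l ∧ ∀ p ∈ F, ¬ (p.1 < v ∧ v < p.2) := by
  simp [uncovered]

open Classical in
/-- The forests on `0, …, l` with `k` arcs. -/
noncomputable def forests (l k : ℕ) : Finset (Finset (ℕ × ℕ)) :=
  ((Finset.range (l + 1) ×ˢ Finset.range (l + 1)).powersetCard k).filter (IsForest l)

theorem mem_forests {l k : ℕ} {F : Finset (ℕ × ℕ)} :
    F ∈ forests l k ↔ IsForest l F ∧ F.card = k := by
  simp only [forests, Finset.mem_filter, Finset.mem_powersetCard]
  constructor
  · tauto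
  · rintro ⟨h, hk⟩
    refine ⟨⟨fun p hp => ?_, hk⟩, h⟩
    have := h.1 p hp
    simp only [Finset.mem_product, Finset.mem_range]
    omega

/-- If arcs start at `x`, the right end of the longest one is uncovered: an arc over it would cover
`x`, be longer, or cross. If none does, `x + 1` is uncovered. -/
theorem IsForest.exists_uncovered_between {l x : ℕ} {F : Finset (ℕ × ℕ)} (hF : IsForest l F)
    (hx : x ∈ uncovered l F) (hxl : x + 2 ≤ l) (hn : (x, l) ∉ F) :
    ∃ y ∈ uncovered l F, x < y := by
  classical
  rw [mem_uncovered] at hx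
  by_cases h : ∃ y, (x, y) ∈ F
  · obtain ⟨y0, hy0⟩ := h
    obtain ⟨p, hp, hmax⟩ := (F.filter (fun p => p.1 = x)).exists_max_image Prod.snd
      ⟨(x, y0), by simp [hy0]⟩
    obtain ⟨hpF, rfl⟩ := Finset.mem_filter.1 hp
    have h1 := hF.1 p hpF
    have hne : p.2 ≠ l := by rintro rfl; exact hn hpF
    refine ⟨p.2, mem_uncovered.2 ⟨by omega, ?_⟩, by omega⟩
    rintro q hq ⟨hq1, hq2⟩
    rcases lt_trichotomy q.1 p.1 with h | h | h
    · exact hx.2 q hq ⟨h, by omega⟩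
    · have := hmax q (by simp [hq, h])
      omega
    · exact hF.2 p hpF q hq ⟨h, hq1, hq2⟩
  · refine ⟨x + 1, mem_uncovered.2 ⟨by omega, ?_⟩, by omega⟩
    rintro ⟨a, b⟩ hq ⟨hq1, hq2⟩
    simp only at hq1 hq2
    rcases Nat.lt_or_ge a x with h' | h'
    · exact hx.2 _ hq ⟨h', by simp only; omega⟩
    · exact h ⟨b, by rwa [show x = a by omega]⟩

theorem zero_mem_uncovered {l : ℕ} (hl : 0 < l) (F : Finset (ℕ × ℕ)) : 0 ∈ uncovered l F := by
  simp [mem_uncovered, hl]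

/-- The arc `(0, l)` covers everything except `0`, and only that arc can. This turns the exclusion
of a side or a diameter into a bound on the number of uncovered vertices. -/
theorem IsForest.one_lt_card_uncovered_iff {l : ℕ} {F : Finset (ℕ × ℕ)} (hF : IsForest l F)
    (hl : 2 ≤ l) : 1 < (uncovered l F).card ↔ (0, l) ∉ F := by
  constructor
  · intro h hm
    obtain ⟨y, hy, hy0⟩ := Finset.exists_mem_ne h 0
    rw [mem_uncovered] at hy
    exact hy.2 _ hm ⟨by simp only; omega, hy.1⟩
  · intro h
    have h0 := zero_mem_uncovered (l := l) (by omega) F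
    obtain ⟨y, hy, hy0⟩ := hF.exists_uncovered_between h0 (by omega) h
    exact Finset.one_lt_card.2 ⟨0, h0, y, hy, by omega⟩

/-! ### Recurrence for forests by number of uncovered vertices -/

/-- The number of forests with `k` arcs and `t` uncovered vertices. -/
noncomputable def forestCount (l t k : ℕ) : ℕ :=
  ((forests l k).filter fun F => (uncovered l F).card = t).card

/-- The number of forests with `k` arcs and more than `t` uncovered vertices. -/
noncomputable def forestCountGT (l t k : ℕ) : ℕ :=
  ((forests l k).filter fun F => t < (uncovered l F).card).card

theorem forestCountGT_eq (l t k : ℕ) :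
    forestCountGT l t k = forestCount l (t + 1) k + forestCountGT l (t + 1) k := by
  classical
  unfold forestCount forestCountGT
  rw [← Finset.card_union_of_disjoint]
  · congr 1
    ext F
    simp only [Finset.mem_filter, Finset.mem_union]
    grind
  · rw [Finset.disjoint_filter]
    intro F _ h
    omega

theorem card_uncovered_le (l : ℕ) (F : Finset (ℕ × ℕ)) : (uncovered l F).card ≤ l :=
  (Finset.card_filter_le _ _).trans (Finset.card_range l).le

theorem forestCountGT_of_le {l t k : ℕ} (h : l ≤ t) : forestCountGT l t k = 0 := by
  unfold forestCountGT
  rw [Finset.card_eq_zero, Finset.filter_eq_empty_iff]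
  intro F _
  have := card_uncovered_le l F
  omega

theorem uncovered_empty (l : ℕ) : uncovered l ∅ = Finset.range l := by
  simp [uncovered]

theorem forests_zero_right (l : ℕ) : forests l 0 = {∅} := by
  ext F
  simp only [mem_forests, Finset.card_eq_zero, Finset.mem_singleton]
  constructor
  · tauto
  · rintro rfl
    simp [IsForest]

theorem forestCountGT_zero_right {l t : ℕ} (h : t < l) : forestCountGT l t 0 = 1 := by
  unfold forestCountGT
  rw [forests_zero_right, Finset.filter_singleton, uncovered_empty, Finset.card_range]
  simp [h]

theorem forestCount_self_succ (t k : ℕ) : forestCount t t (k + 1) = 0 := by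
  unfold forestCount
  rw [Finset.card_eq_zero, Finset.filter_eq_empty_iff]
  intro F hF h
  rw [mem_forests] at hF
  obtain ⟨p, hp⟩ : F.Nonempty := Finset.card_pos.1 (by omega)
  have h1 := hF.1.1 p hp
  have h2 : uncovered t F = Finset.range t :=
    Finset.eq_of_subset_of_card_le (Finset.filter_subset _ _) (by simp [h])
  have h3 : p.1 + 1 ∈ uncovered t F := by rw [h2, Finset.mem_range]; omega
  exact (mem_uncovered.1 h3).2 p hp ⟨by omega, by omega⟩

theorem forestCount_zero_mid {l : ℕ} (hl : 0 < l) (k : ℕ) : forestCount l 0 k = 0 := by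
  unfold forestCount
  rw [Finset.card_eq_zero, Finset.filter_eq_empty_iff]
  intro F hF h
  rw [Finset.card_eq_zero] at h
  simpa [h] using zero_mem_uncovered hl F

open Classical in
-- When no arc ends at `l + 1`, the vertex `l` is uncovered; dropping the last vertex loses exactly
-- this one from the count.
theorem card_filter_no_arc_to_last (l t k : ℕ) :
    ((forests (l + 1) k).filter fun F =>
      (uncovered (l + 1) F).card = t + 1 ∧ ∀ x, (x, l + 1) ∉ F).card = forestCount l t k := by
  unfold forestCount
  congr 1
  ext F
  simp only [Finset.mem_filter, mem_forests]
  have key : (∀ p ∈ F, p.2 ≤ l) → (uncovered (l + 1) F).card = (uncovered l F).card + 1 := by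
    intro h
    have : uncovered (l + 1) F = insert l (uncovered l F) := by
      ext v
      simp only [Finset.mem_insert, mem_uncovered]
      constructor
      · rintro ⟨h1, h2⟩
        rcases Nat.lt_or_ge v l with h3 | h3
        · exact Or.inr ⟨h3, h2⟩
        · left; omega
      · rintro (rfl | h1)
        · refine ⟨by omega, fun p hp => ?_⟩
          have := h p hp
          omega
        · exact ⟨by omega, h1.2⟩
    rw [this, Finset.card_insert_of_notMem]
    simp [mem_uncovered]
  constructor
  · rintro ⟨⟨h1, h2⟩, h3, h4⟩
    have h5 : ∀ p ∈ F, p.2 ≤ l := by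
      intro p hp
      have := (h1.1 p hp).2
      by_contra hc
      exact h4 p.1 (by rwa [show l + 1 = p.2 by omega])
    rw [key h5] at h3
    exact ⟨⟨⟨fun p hp => ⟨(h1.1 p hp).1, h5 p hp⟩, h1.2⟩, h2⟩, by omega⟩
  · rintro ⟨⟨h1, h2⟩, h3⟩
    refine ⟨⟨⟨fun p hp => ⟨(h1.1 p hp).1, by have := h1.1 p hp; omega⟩, h1.2⟩, h2⟩, ?_, ?_⟩
    · rw [key (fun p hp => (h1.1 p hp).2), h3]
    · intro x hx
      have := (h1.1 _ hx).2
      simp only at this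
      omega

theorem uncovered_insert_last {l x : ℕ} (F : Finset (ℕ × ℕ)) :
    uncovered l (insert (x, l) F) = (uncovered l F).filter (· ≤ x) := by
  ext v
  simp only [mem_uncovered, Finset.mem_filter, Finset.forall_mem_insert]
  constructor
  · rintro ⟨h1, h2, h3⟩
    exact ⟨⟨h1, h3⟩, by omega⟩
  · rintro ⟨⟨h1, h2⟩, h3⟩
    exact ⟨h1, by omega, h2⟩

/-- A forest with an arc to the last vertex loses its longest such arc. -/
theorem IsForest.exists_insert_last {l : ℕ} {F : Finset (ℕ × ℕ)} (hF : IsForest l F)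
    (h : ∃ x, (x, l) ∈ F) :
    ∃ x, (x, l) ∈ F ∧ IsForest l (F.erase (x, l)) ∧ x ∈ uncovered l (F.erase (x, l)) ∧
      ∃ y ∈ uncovered l (F.erase (x, l)), x < y := by
  classical
  obtain ⟨x0, hx0⟩ := h
  -- The longest arc to `l` has the smallest left end. An arc over that end would cross it if it
  -- stopped before `l`, and be longer if it reached `l`.
  obtain ⟨p, hp, hmin⟩ := (F.filter (fun p => p.2 = l)).exists_min_image Prod.fst
    ⟨(x0, l), by simp [hx0]⟩
  obtain ⟨x, y⟩ := p
  obtain ⟨hpF, h2⟩ := Finset.mem_filter.1 hp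
  simp only at h2
  subst h2
  have h1 := hF.1 _ hpF
  simp only at h1
  have hF' : IsForest y (F.erase (x, y)) :=
    ⟨fun p hp => hF.1 p (Finset.mem_of_mem_erase hp),
      fun p hp q hq => hF.2 p (Finset.mem_of_mem_erase hp) q (Finset.mem_of_mem_erase hq)⟩
  have hx : x ∈ uncovered y (F.erase (x, y)) := by
    refine mem_uncovered.2 ⟨by omega, ?_⟩
    rintro q hq ⟨hq1, hq2⟩
    have hq' := Finset.mem_of_mem_erase hq
    have h3 := (hF.1 q hq').2
    rcases h3.lt_or_eq with h4 | h4
    · exact hF.2 q hq' _ hpF ⟨hq1, hq2, h4⟩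
    · have := hmin q (by simp [hq', h4])
      simp only at this
      omega
  exact ⟨x, hpF, hF', hx, hF'.exists_uncovered_between hx h1.1 (by simp)⟩

/-- The vertex `y`, strictly between `x` and `l`, guarantees that the new arc spans two steps. -/
theorem IsForest.insert_last {l x y : ℕ} {F : Finset (ℕ × ℕ)} (hF : IsForest l F)
    (hx : x ∈ uncovered l F) (hy : y ∈ uncovered l F) (hxy : x < y) :
    IsForest l (insert (x, l) F) := by
  rw [mem_uncovered] at hx hy
  refine ⟨?_, ?_⟩
  · rw [Finset.forall_mem_insert]
    exact ⟨⟨by simp only; omega, le_rfl⟩, hF.1⟩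
  · simp only [Finset.forall_mem_insert]
    refine ⟨⟨by omega, fun q hq h => ?_⟩, fun p hp => ⟨fun h => hx.2 p hp ⟨h.1, h.2.1⟩, hF.2 p hp⟩⟩
    have := (hF.1 q hq).2
    omega

theorem exists_mem_card_filter_le (s : Finset ℕ) (t : ℕ) (h : t + 1 < s.card) :
    ∃ x ∈ s, (s.filter (· ≤ x)).card = t + 1 ∧ ∃ y ∈ s, x < y := by
  set e := s.orderEmbOfFin rfl
  have hfil : s.filter (· ≤ e ⟨t, by omega⟩)
      = (Finset.univ.filter (fun i : Fin s.card => i.1 ≤ t)).map e.toEmbedding := by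
    ext v
    simp only [Finset.mem_filter, Finset.mem_map, Finset.mem_univ, true_and]
    constructor
    · rintro ⟨hv, hle⟩
      have : v ∈ Set.range e := by rw [Finset.range_orderEmbOfFin]; exact hv
      obtain ⟨i, rfl⟩ := this
      exact ⟨i, e.le_iff_le.1 hle, rfl⟩
    · rintro ⟨i, hi, rfl⟩
      exact ⟨Finset.orderEmbOfFin_mem _ _ _, e.le_iff_le.2 hi⟩
  refine ⟨e ⟨t, by omega⟩, Finset.orderEmbOfFin_mem _ _ _, ?_, e ⟨t + 1, h⟩,
    Finset.orderEmbOfFin_mem _ _ _, e.lt_iff_lt.2 (by simp)⟩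
  rw [hfil, Finset.card_map]
  have h2 : (Finset.univ.filter (fun i : Fin s.card => i.1 ≤ t)) =
      Finset.Iic (⟨t, by omega⟩ : Fin s.card) := by
    ext i; simp [Fin.le_def]
  rw [h2, Fin.card_Iic]

open Classical in
-- Deleting the longest arc to `l` exposes at least one more vertex. Conversely, exactly `t + 1`
-- vertices stay uncovered only if the new arc starts at the `(t + 1)`-st uncovered vertex, so the
-- deletion is a bijection.
theorem card_filter_arc_to_last (l t k : ℕ) :
    ((forests l (k + 1)).filter fun F =>
      (uncovered l F).card = t + 1 ∧ ∃ x, (x, l) ∈ F).card = forestCountGT l (t + 1) k := by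
  unfold forestCountGT
  have ex : ∀ F ∈ (forests l (k + 1)).filter fun F =>
      (uncovered l F).card = t + 1 ∧ ∃ x, (x, l) ∈ F,
      ∃ x, (x, l) ∈ F ∧ IsForest l (F.erase (x, l)) ∧ x ∈ uncovered l (F.erase (x, l)) ∧
        ∃ y ∈ uncovered l (F.erase (x, l)), x < y := by
    intro F hF
    simp only [Finset.mem_filter, mem_forests] at hF
    exact hF.1.1.exists_insert_last hF.2.2
  choose g hg using ex
  have hunc : ∀ F (hF : F ∈ (forests l (k + 1)).filter fun F =>
      (uncovered l F).card = t + 1 ∧ ∃ x, (x, l) ∈ F),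
      ((uncovered l (F.erase (g F hF, l))).filter (· ≤ g F hF)).card = t + 1 := by
    intro F hF
    obtain ⟨h1, h2, h3, h4⟩ := hg F hF
    rw [← uncovered_insert_last, Finset.insert_erase h1]
    exact (Finset.mem_filter.1 hF).2.1
  refine Finset.card_bij (fun F hF => Finset.erase F (g F hF, l)) ?_ ?_ ?_
  · intro F hF
    obtain ⟨h1, h2, h3, y, h4, h5⟩ := hg F hF
    simp only [Finset.mem_filter, mem_forests]
    refine ⟨⟨h2, ?_⟩, ?_⟩
    · rw [Finset.card_erase_of_mem h1]
      have := Finset.mem_filter.1 hF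
      rw [mem_forests] at this
      omega
    · rw [← hunc F hF]
      refine Finset.card_lt_card (Finset.filter_ssubset.2 ⟨y, h4, by omega⟩)
  · intro F₁ h₁ F₂ h₂ heq
    have hc₁ := hunc F₁ h₁
    have hc₂ := hunc F₂ h₂
    obtain ⟨m₁, -, u₁, -⟩ := hg F₁ h₁
    obtain ⟨m₂, -, u₂, -⟩ := hg F₂ h₂
    -- Both left ends are the uncovered vertex of the same rank in the common remaining forest.
    have hx : g F₁ h₁ = g F₂ h₂ := by
      rw [← show _ = _ from heq] at hc₂ u₂
      have mono : ∀ (s : Finset ℕ) (a b : ℕ), b ∈ s → a < b →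
          (s.filter (· ≤ a)).card < (s.filter (· ≤ b)).card := by
        intro s a b hb hab
        refine Finset.card_lt_card ⟨fun v hv => ?_, fun h => ?_⟩
        · simp only [Finset.mem_filter] at hv ⊢
          exact ⟨hv.1, by omega⟩
        · have := h (Finset.mem_filter.2 ⟨hb, le_rfl⟩)
          simp only [Finset.mem_filter] at this
          omega
      rcases lt_trichotomy (g F₁ h₁) (g F₂ h₂) with h | h | h
      · have := mono _ _ _ u₂ h
        omega
      · exact h
      · have := mono _ _ _ u₁ h
        omega
    rw [← Finset.insert_erase m₁, heq, hx, Finset.insert_erase m₂]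
  · intro F' hF'
    simp only [Finset.mem_filter, mem_forests] at hF'
    obtain ⟨⟨hfor, hk⟩, ht⟩ := hF'
    obtain ⟨x, hx, hcard, y, hy, hxy⟩ := exists_mem_card_filter_le _ t ht
    have hnot : (x, l) ∉ F' := fun h =>
      (mem_uncovered.1 hy).2 _ h ⟨hxy, (mem_uncovered.1 hy).1⟩
    have hmem : insert (x, l) F' ∈ (forests l (k + 1)).filter fun F =>
        (uncovered l F).card = t + 1 ∧ ∃ x, (x, l) ∈ F := by
      simp only [Finset.mem_filter, mem_forests]
      refine ⟨⟨hfor.insert_last hx hy hxy, ?_⟩, ?_, x, Finset.mem_insert_self _ _⟩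
      · rw [Finset.card_insert_of_notMem hnot, hk]
      · rw [uncovered_insert_last, hcard]
    refine ⟨_, hmem, ?_⟩
    obtain ⟨m, -, u, -⟩ := hg _ hmem
    have : g _ hmem = x := by
      -- Of two arcs to `l`, the longer covers the left end of the shorter; since neither left end
      -- is covered, the arcs agree.
      by_contra hne
      have h1 : (g _ hmem, l) ∈ F' := Finset.mem_of_mem_insert_of_ne m (by simpa using hne)
      have h2 := (mem_uncovered.1 u).2 (x, l) (by simp [Ne.symm hne])
      have h3 := (mem_uncovered.1 hx).2 _ h1
      have h4 := (hfor.1 _ h1)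
      have h5 := (mem_uncovered.1 hx).1
      simp only at h2 h3 h4
      omega
    rw [this, Finset.erase_insert hnot]

theorem forestCount_succ (l t k : ℕ) :
    forestCount (l + 1) (t + 1) (k + 1) =
      forestCount l t (k + 1) + forestCountGT (l + 1) (t + 1) k := by
  classical
  rw [← card_filter_no_arc_to_last l t, ← card_filter_arc_to_last (l + 1) t]
  unfold forestCount
  rw [← Finset.card_filter_add_card_filter_not 
      (s := (forests (l + 1) (k + 1)).filter _) (fun F => ∀ x, (x, l + 1) ∉ F),
    Finset.filter_filter, Finset.filter_filter]
  simp only [not_forall, not_not]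

/-! ### Closed form for forest counts -/

/-- Ballot-type formula for the number of forests, together with its summed form. -/
theorem forestCount_formula (k : ℕ) :
    (∀ t s : ℕ, ((t + s + 1 : ℕ) : ℚ) * forestCount (t + s + 1) t (k + 1) =
      t * (t + s + 1 + k).choose (k + 1) * s.choose k) ∧
    (∀ t s : ℕ, ((t + s + 1 : ℕ) : ℚ) * forestCountGT (t + s + 1) t k =
      (t + s + k).choose k * (t * s.choose k + (s + 1).choose (k + 1))) := by
  -- The two formulas are proved alternately. The summed form for `k` arcs gives the exact count for
  -- `k + 1` arcs, by induction on `t` with `s` fixed.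
  have stepA : ∀ k, (∀ t s : ℕ, ((t + s + 1 : ℕ) : ℚ) * forestCountGT (t + s + 1) t k =
      (t + s + k).choose k * (t * s.choose k + (s + 1).choose (k + 1))) →
      ∀ t s : ℕ, ((t + s + 1 : ℕ) : ℚ) * forestCount (t + s + 1) t (k + 1) =
      t * (t + s + 1 + k).choose (k + 1) * s.choose k := by
    intro k hB t s
    induction t with
    | zero => rw [forestCount_zero_mid (by omega)]; simp
    | succ t ih =>
      have hb := hB (t + 1) s
      rw [show t + 1 + s + 1 = t + s + 1 + 1 by ring] at hb ⊢
      rw [forestCount_succ]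
      have e1 : ((t + s + 1 + 1 + k).choose (k + 1) : ℚ) * (k + 1) =
          (t + s + 1 + 1 + k) * (t + s + 1 + k).choose k := by
        have := Nat.add_one_mul_choose_eq (t + s + 1 + k) k
        have h' : t + s + 1 + 1 + k = t + s + 1 + k + 1 := by ring
        rw [h']
        have h2 : (((t + s + 1 + k + 1) * (t + s + 1 + k).choose k : ℕ) : ℚ) =
          (((t + s + 1 + k + 1).choose (k + 1) * (k + 1) : ℕ) : ℚ) := by exact_mod_cast this
        push_cast at h2
        linear_combination -h2
      have e2 : ((t + s + 1 + k).choose (k + 1) : ℚ) * (k + 1) =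
          (t + s + 1) * (t + s + 1 + k).choose k := by
        have := Nat.choose_succ_right_eq (t + s + 1 + k) k
        rw [Nat.add_sub_cancel] at this
        have h2 : (((t + s + 1 + k).choose (k + 1) * (k + 1) : ℕ) : ℚ) =
          (((t + s + 1 + k).choose k * (t + s + 1) : ℕ) : ℚ) := by exact_mod_cast this
        push_cast at h2
        linear_combination h2
      have e3 : ((s + 1).choose (k + 1) : ℚ) * (k + 1) = (s + 1) * s.choose k := by
        have := Nat.add_one_mul_choose_eq s k
        have h2 : (((s + 1) * s.choose k : ℕ) : ℚ) =
          (((s + 1).choose (k + 1) * (k + 1) : ℕ) : ℚ) := by exact_mod_cast this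
        push_cast at h2
        linear_combination -h2
      rw [show t + 1 + s + k = t + s + 1 + k by ring] at hb
      push_cast at hb ih ⊢
      set X : ℚ := (forestCount (t + s + 1) t (k + 1) : ℚ)
      set Y : ℚ := (forestCountGT (t + s + 1 + 1) (t + 1) k : ℚ)
      set c : ℚ := ((t + s + 1 + k).choose k : ℚ)
      set c1 : ℚ := ((t + s + 1 + 1 + k).choose (k + 1) : ℚ)
      set c2 : ℚ := ((t + s + 1 + k).choose (k + 1) : ℚ)
      set z : ℚ := (s.choose k : ℚ)
      set z1 : ℚ := ((s + 1).choose (k + 1) : ℚ)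
      have hk : (k : ℚ) + 1 ≠ 0 := by positivity
      have hl : (t : ℚ) + s + 1 ≠ 0 := by positivity
      -- The induction hypothesis has prefactor `t + s + 1`, the goal `t + s + 2`. Multiplying by `k
      -- + 1` lets the former cancel.
      have hX : X * (k + 1) = t * c * z := by
        apply mul_left_cancel₀ hl
        linear_combination (k + 1 : ℚ) * ih + (t : ℚ) * z * e2
      apply mul_left_cancel₀ hk
      linear_combination (t + s + 1 + 1 : ℚ) * hX + (k + 1 : ℚ) * hb + c * e3
        - (t + 1 : ℚ) * z * e1
  -- Conversely, the exact counts are summed over larger `t`. Here `l = t + s + 1` stays fixed, and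
  -- Pascal's rule makes the sum telescope.
  have stepB : ∀ k, (∀ t s : ℕ, ((t + s + 1 : ℕ) : ℚ) * forestCount (t + s + 1) t (k + 1) =
      t * (t + s + 1 + k).choose (k + 1) * s.choose k) →
      (∀ t s : ℕ, ((t + s + 1 : ℕ) : ℚ) * forestCountGT (t + s + 1) t (k + 1) =
      (t + s + (k + 1)).choose (k + 1) * (t * s.choose (k + 1) + (s + 1).choose (k + 1 + 1))) := by
    intro k hA t s
    induction s generalizing t with
    | zero =>
      rw [forestCountGT_eq, forestCountGT_of_le (by omega), add_zero, add_zero,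
        forestCount_self_succ, Nat.choose_eq_zero_of_lt (show 0 + 1 < k + 1 + 1 by omega)]
      simp
    | succ s ih =>
      rw [forestCountGT_eq]
      have h1 := hA (t + 1) s
      have h2 := ih (t + 1)
      rw [show t + 1 + s + 1 = t + (s + 1) + 1 by ring] at h1 h2
      rw [show t + (s + 1) + 1 + k = t + (s + 1) + (k + 1) by ring] at h1
      rw [show t + 1 + s + (k + 1) = t + (s + 1) + (k + 1) by ring] at h2
      push_cast [Nat.choose_succ_succ] at h1 h2 ⊢
      linear_combination h1 + h2
  induction k with
  | zero =>
    have hB : ∀ t s : ℕ, ((t + s + 1 : ℕ) : ℚ) * forestCountGT (t + s + 1) t 0 =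
      (t + s + 0).choose 0 * (t * s.choose 0 + (s + 1).choose (0 + 1)) := by
      intro t s
      rw [forestCountGT_zero_right (by omega)]
      simp
      ring
    exact ⟨stepA 0 hB, hB⟩
  | succ k ih =>
    have hB := stepB k ih.1
    exact ⟨stepA (k + 1) hB, hB⟩

/-! ### Integer labels for polygon vertices and chords -/

section Vertices

variable {n : ℕ} [NeZero n]

/-- The vertex of the `n`-gon reached from vertex `0` after `i` steps along the boundary. -/
def vtx (n : ℕ) [NeZero n] (i : ℤ) : Fin n :=
  ⟨(i % n).toNat, by
    have h : (0 : ℤ) < n := by exact_mod_cast Nat.pos_of_ne_zero (NeZero.ne n)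
    have := Int.emod_nonneg i h.ne'
    have := Int.emod_lt_of_pos i h
    omega⟩

theorem natCast_pos_of_neZero (n : ℕ) [NeZero n] : (0 : ℤ) < n := by
  exact_mod_cast Nat.pos_of_ne_zero (NeZero.ne n)

theorem vtx_val (i : ℤ) : ((vtx n i).val : ℤ) = i % n :=
  Int.toNat_of_nonneg (Int.emod_nonneg i (natCast_pos_of_neZero n).ne')

theorem vtx_eq_iff {i j : ℤ} : vtx n i = vtx n j ↔ ∃ c : ℤ, j = i + c * n := by
  rw [Fin.ext_iff, ← Int.natCast_inj, vtx_val, vtx_val]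
  constructor
  · intro h
    obtain ⟨c, hc⟩ := Int.ModEq.dvd (show i ≡ j [ZMOD n] from h)
    exact ⟨c, by linarith⟩
  · rintro ⟨c, rfl⟩
    simp

theorem vtx_coe (a : Fin n) : vtx n (a.val : ℤ) = a := by
  rw [Fin.ext_iff, ← Int.natCast_inj, vtx_val]
  exact Int.emod_eq_of_lt (by positivity) (by exact_mod_cast a.2)

theorem vtx_add_mul (i c : ℤ) : vtx n (i + c * n) = vtx n i :=
  (vtx_eq_iff.2 ⟨c, rfl⟩).symm

theorem vtx_add_n (i : ℤ) : vtx n (i + n) = vtx n i := by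
  simpa using vtx_add_mul (n := n) i 1

theorem vtx_ne {i j : ℤ} (h : i < j) (h' : j < i + n) : vtx n i ≠ vtx n j := by
  intro e
  obtain ⟨c, hc⟩ := vtx_eq_iff.1 e
  have h1 : 0 < c * n := by linarith
  have h2 : c * n < 1 * n := by linarith
  have hn := natCast_pos_of_neZero n
  have h3 : 0 < c := pos_of_mul_pos_left h1 hn.le
  have h4 := lt_of_mul_lt_mul_right h2 hn.le
  omega

/-- Congruent integers less than `n` apart in absolute value coincide. -/
theorem eq_of_vtx_eq {i j : ℤ} (e : vtx n i = vtx n j) (h : i < j + n) (h' : j < i + n) :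
    i = j := by
  rcases lt_trichotomy i j with h1 | h1 | h1
  · exact absurd e (vtx_ne h1 h')
  · exact h1
  · exact absurd e.symm (vtx_ne h1 h)

/-- Every vertex has a representative in any window of `n` consecutive integers. -/
theorem exists_vtx_eq (a : Fin n) (x : ℤ) : ∃ i, x ≤ i ∧ i < x + n ∧ vtx n i = a := by
  have hn := natCast_pos_of_neZero n
  refine ⟨x + (a.val - x) % n, ?_, ?_, ?_⟩
  · linarith [Int.emod_nonneg (a.val - x) hn.ne']
  · linarith [Int.emod_lt_of_pos (a.val - x) hn]
  · rw [← vtx_coe a, vtx_eq_iff, vtx_coe]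
    exact ⟨(a.val - x) / n, by linarith [Int.emod_add_mul_ediv (a.val - x : ℤ) n]⟩

theorem exists_eq_mk_vtx (e : Sym2 (Fin n)) (x : ℤ) :
    ∃ i j : ℤ, x ≤ i ∧ i ≤ j ∧ j < x + n ∧ e = s(vtx n i, vtx n j) := by
  induction e with | h a b => ?_
  obtain ⟨i, hi, hi', rfl⟩ := exists_vtx_eq a x
  obtain ⟨j, hj, hj', rfl⟩ := exists_vtx_eq b x
  rcases le_total i j with h | h
  · exact ⟨i, j, hi, h, hj', rfl⟩
  · exact ⟨j, i, hj, h, hi', Sym2.eq_swap⟩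

theorem finRotate_vtx (i : ℤ) : finRotate n (vtx n i) = vtx n (i + 1) := by
  rw [finRotate_apply, Fin.ext_iff, Fin.val_add, ← Int.natCast_inj, vtx_val]
  push_cast
  rw [vtx_val, Fin.val_one', Int.natCast_mod]
  simp

theorem finRotate_zpow_vtx (r i : ℤ) : (finRotate n ^ r) (vtx n i) = vtx n (i + r) := by
  induction r using Int.induction_on generalizing i with
  | zero => simp
  | succ k ih => rw [zpow_add_one, Equiv.Perm.mul_apply, finRotate_vtx, ih]; congr 1; ring
  | pred k ih =>
    have h : (finRotate n)⁻¹ (vtx n i) = vtx n (i - 1) := by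
      rw [Equiv.Perm.inv_eq_iff_eq, finRotate_vtx]; congr 1; ring
    rw [zpow_sub_one, Equiv.Perm.mul_apply, h, ih]; congr 1; ring

theorem isDiagonal_vtx_iff {i j : ℤ} (h : i < j) (h' : j < i + n) :
    IsDiagonal n s(vtx n i, vtx n j) ↔ i + 2 ≤ j ∧ j + 2 ≤ i + n := by
  have key : IsDiagonal n s(vtx n i, vtx n j) ↔
      vtx n (i + 1) ≠ vtx n j ∧ vtx n (j + 1) ≠ vtx n i := by
    rw [← finRotate_vtx, ← finRotate_vtx]
    constructor
    · rintro ⟨a, b, hab, -, h2, h3⟩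
      rcases Sym2.eq_iff.1 hab with ⟨rfl, rfl⟩ | ⟨rfl, rfl⟩
      · exact ⟨h2, h3⟩
      · exact ⟨h3, h2⟩
    · rintro ⟨h2, h3⟩
      exact ⟨_, _, rfl, vtx_ne h h', h2, h3⟩
  rw [key]
  constructor
  · rintro ⟨h1, h2⟩
    refine ⟨?_, ?_⟩
    · by_contra hc
      exact h1 (by congr 1; omega)
    · by_contra hc
      exact h2 (by rw [← vtx_add_n i]; congr 1; omega)
  · rintro ⟨h1, h2⟩
    refine ⟨vtx_ne (by omega) (by omega), ?_⟩
    rw [← vtx_add_n i]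
    exact vtx_ne (by omega) (by omega)

theorem IsDiagonal.exists_vtx {e : Sym2 (Fin n)} (h : IsDiagonal n e) (x : ℤ) :
    ∃ i j : ℤ, x ≤ i ∧ i + 2 ≤ j ∧ j < x + n ∧ j + 2 ≤ i + n ∧ e = s(vtx n i, vtx n j) := by
  obtain ⟨i, j, h1, h2, h3, rfl⟩ := exists_eq_mk_vtx e x
  have h4 : i < j := by
    rcases h2.lt_or_eq with h4 | rfl
    · exact h4
    · obtain ⟨a, b, hab, hne, -⟩ := h
      rcases Sym2.eq_iff.1 hab with ⟨rfl, rfl⟩ | ⟨rfl, rfl⟩ <;> exact absurd rfl hne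
  have h5 := (isDiagonal_vtx_iff h4 (by omega)).1 h
  exact ⟨i, j, h1, h5.1, h3, h5.2, rfl⟩

theorem vtx_lt_vtx {i j : ℤ} (h0 : 0 ≤ i) (h : i < j) (hj : j < n) : vtx n i < vtx n j := by
  rw [Fin.lt_def, ← Int.ofNat_lt, vtx_val, vtx_val, Int.emod_eq_of_lt h0 (by omega),
    Int.emod_eq_of_lt (by omega) hj]
  exact h

/-- `Crosses` uses the linear order of `Fin n`; this lemma and `Crosses.exists_vtx` make it cyclic.
Once `i` is moved into `[0, n)`, the cases are how many of `j`, `k`, `l` pass `n`. -/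
theorem crosses_vtx {i j k l : ℤ} (h1 : i < j) (h2 : j < k) (h3 : k < l) (h4 : l < i + n) :
    Crosses s(vtx n i, vtx n k) s(vtx n j, vtx n l) := by
  have hn := natCast_pos_of_neZero n
  wlog h0 : 0 ≤ i ∧ i < n generalizing i j k l
  · have := this (i := i + (-(i / n)) * n) (j := j + (-(i / n)) * n) (k := k + (-(i / n)) * n)
      (l := l + (-(i / n)) * n) (by omega) (by omega) (by omega) (by omega) (by
        have e := Int.emod_add_mul_ediv i n
        have e1 := Int.emod_nonneg i hn.ne'
        have e2 := Int.emod_lt_of_pos i hn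
        constructor <;> linarith)
    simpa only [vtx_add_mul] using this
  have hs : ∀ x, vtx n x = vtx n (x - n) := fun x => by
    conv_lhs => rw [← sub_add_cancel x (n : ℤ), vtx_add_n]
  rcases lt_or_ge l n with hl | hl
  · exact ⟨_, _, _, _, vtx_lt_vtx h0.1 h1 (by omega), vtx_lt_vtx (by omega) h2 (by omega),
      vtx_lt_vtx (by omega) h3 hl, Or.inl ⟨rfl, rfl⟩⟩
  rcases lt_or_ge k n with hk | hk
  · rw [hs l]
    exact ⟨_, _, _, _, vtx_lt_vtx (by omega) (show l - n < i by omega) (by omega),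
      vtx_lt_vtx h0.1 h1 (by omega), vtx_lt_vtx (by omega) h2 hk, Or.inr ⟨rfl, Sym2.eq_swap⟩⟩
  rcases lt_or_ge j n with hj | hj
  · rw [hs l, hs k]
    exact ⟨_, _, _, _, vtx_lt_vtx (by omega) (show k - n < l - n by omega) (by omega),
      vtx_lt_vtx (by omega) (show l - n < i by omega) (by omega), vtx_lt_vtx h0.1 h1 hj,
      Or.inl ⟨Sym2.eq_swap, Sym2.eq_swap⟩⟩
  · rw [hs l, hs k, hs j]
    exact ⟨_, _, _, _, vtx_lt_vtx (by omega) (show j - n < k - n by omega) (by omega),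
      vtx_lt_vtx (by omega) (show k - n < l - n by omega) (by omega),
      vtx_lt_vtx (by omega) (show l - n < i by omega) (by omega), Or.inr ⟨Sym2.eq_swap, rfl⟩⟩

theorem Crosses.exists_vtx {i k : ℤ} {f : Sym2 (Fin n)} (h : Crosses s(vtx n i, vtx n k) f)
    (hik : i ≤ k) (hki : k < i + n) :
    ∃ j l : ℤ, i < j ∧ j < k ∧ k < l ∧ l < i + n ∧ f = s(vtx n j, vtx n l) := by
  obtain ⟨a, b, c, d, hab, hbc, hcd, h⟩ := h
  obtain ⟨x, hx⟩ : ∃ x : ℤ, x = a.val := ⟨_, rfl⟩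
  obtain ⟨y, hy⟩ : ∃ y : ℤ, y = b.val := ⟨_, rfl⟩
  obtain ⟨z, hz⟩ : ∃ z : ℤ, z = c.val := ⟨_, rfl⟩
  obtain ⟨w, hw⟩ : ∃ w : ℤ, w = d.val := ⟨_, rfl⟩
  have h1 : 0 ≤ x ∧ x < y ∧ y < z ∧ z < w ∧ w < n := by
    rw [Fin.lt_def] at hab hbc hcd
    have := d.2
    omega
  have ha : vtx n x = a := by rw [hx, vtx_coe]
  have hb : vtx n y = b := by rw [hy, vtx_coe]
  have hc : vtx n z = c := by rw [hz, vtx_coe]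
  have hd : vtx n w = d := by rw [hw, vtx_coe]
  clear hx hy hz hw hab hbc hcd
  subst ha hb hc hd
  -- The endpoint matching `i` can be any of the four alternating points, so the quadruple is read
  -- cyclically from there and then translated to start at `i`.
  have lift : ∀ p q u v : ℤ, p < q → q < u → u < v → v < p + n →
      vtx n i = vtx n p → vtx n k = vtx n u → f = s(vtx n q, vtx n v) →
      ∃ j l : ℤ, i < j ∧ j < k ∧ k < l ∧ l < i + n ∧ f = s(vtx n j, vtx n l) := by
    intro p q u v h1 h2 h3 h4 hi hk hf
    obtain ⟨t, rfl⟩ := vtx_eq_iff.1 hi.symm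
    have hk' : k = u + t * n := eq_of_vtx_eq (by rw [hk, vtx_add_mul]) (by omega) (by omega)
    subst hk'
    exact ⟨q + t * n, v + t * n, by omega, by omega, by omega, by omega, by
      rw [hf, vtx_add_mul, vtx_add_mul]⟩
  rcases h with ⟨he, hf⟩ | ⟨he, hf⟩
  · rcases Sym2.eq_iff.1 he with ⟨hi, hk⟩ | ⟨hi, hk⟩
    · exact lift x y z w (by omega) (by omega) (by omega) (by omega) hi hk hf
    · exact lift z w (x + n) (y + n) (by omega) (by omega) (by omega) (by omega) hi
        (by rw [hk, vtx_add_n]) (by rw [hf, vtx_add_n, Sym2.eq_swap])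
  · rcases Sym2.eq_iff.1 he with ⟨hi, hk⟩ | ⟨hi, hk⟩
    · exact lift y z w (x + n) (by omega) (by omega) (by omega) (by omega) hi hk
        (by rw [hf, vtx_add_n, Sym2.eq_swap])
    · exact lift w (x + n) (y + n) (z + n) (by omega) (by omega) (by omega) (by omega) hi
        (by rw [hk, vtx_add_n]) (by rw [hf, vtx_add_n, vtx_add_n])

end Vertices

/-! ### Forests weighted by the inverse number of uncovered vertices -/

/-- The forests with `k` arcs and more than `t` uncovered vertices, each weighted by the inverse
of its number of uncovered vertices. -/
noncomputable def forestWeight (l t k : ℕ) : ℚ :=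
  ∑ F ∈ (forests l k).filter (fun F => t < (uncovered l F).card),
    ((uncovered l F).card : ℚ)⁻¹

theorem forestWeight_eq (l t k : ℕ) :
    forestWeight l t k = forestCount l (t + 1) k * ((t + 1 : ℕ) : ℚ)⁻¹ + forestWeight l (t + 1) k := by
  unfold forestWeight
  rw [← Finset.sum_filter_add_sum_filter_not _ (fun F => (uncovered l F).card = t + 1)]
  congr 1
  · rw [Finset.filter_filter, Finset.sum_congr rfl (g := fun _ => ((t + 1 : ℕ) : ℚ)⁻¹),
      Finset.sum_const, nsmul_eq_mul]
    · congr 2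
      unfold forestCount
      congr 1
      exact Finset.filter_congr fun F _ => by omega
    · intro F hF
      rw [(Finset.mem_filter.1 hF).2.2]
  · rw [Finset.filter_filter]
    refine Finset.sum_congr (Finset.filter_congr fun F _ => by omega) fun _ _ => rfl

theorem forestWeight_of_le {l t k : ℕ} (h : l ≤ t) : forestWeight l t k = 0 := by
  unfold forestWeight
  rw [Finset.filter_eq_empty_iff.2, Finset.sum_empty]
  intro F _
  have := card_uncovered_le l F
  omega

/-- The weight cancels the linear factor of the ballot formula. With the number of vertices fixed,
the first binomial is constant and the second sums by Pascal's rule. -/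
theorem forestWeight_formula (t s k : ℕ) :
    ((t + s + 1 : ℕ) : ℚ) * forestWeight (t + s + 1) t k =
      (t + s + k).choose k * s.choose k := by
  cases k with
  | zero =>
    unfold forestWeight
    rw [forests_zero_right, Finset.filter_singleton, uncovered_empty, Finset.card_range,
      if_pos (by omega), Finset.sum_singleton, uncovered_empty, Finset.card_range]
    rw [mul_inv_cancel₀ (by positivity)]
    simp
  | succ k =>
    induction s generalizing t with
    | zero =>
      rw [forestWeight_eq, forestWeight_of_le (by omega), add_zero, forestCount_self_succ]
      simp
    | succ s ih =>
      have h1 := (forestCount_formula k).1 (t + 1) s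
      have h2 := ih (t + 1)
      have ht : ((t + 1 : ℕ) : ℚ) ≠ 0 := by positivity
      rw [forestWeight_eq, mul_add, ← mul_assoc]
      rw [show t + 1 + s + 1 = t + (s + 1) + 1 by ring] at h1 h2
      rw [show t + (s + 1) + 1 + k = t + (s + 1) + (k + 1) by ring] at h1
      rw [show t + 1 + s + (k + 1) = t + (s + 1) + (k + 1) by ring] at h2
      rw [h1, h2, Nat.choose_succ_succ s k]
      field_simp
      push_cast
      ring

/-! ### Periodic dissections as unrolled forests -/

/-- `D` is a set of pairwise noncrossing diagonals of the `n`-gon. -/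
def IsDissection (n : ℕ) (D : Finset (Sym2 (Fin n))) : Prop :=
  (∀ e ∈ D, IsDiagonal n e) ∧ ∀ e ∈ D, ∀ f ∈ D, ¬ Crosses e f

theorem eq_of_add_mul_eq {m i i' c c' : ℤ} (h : i + c * m = i' + c' * m) (hi : 0 ≤ i) (hi' : 0 ≤ i')
    (him : i < m) (him' : i' < m) : i = i' ∧ c = c' := by
  have h1 : i = i' := by
    have := congrArg (· % m) h
    simpa [Int.emod_eq_of_lt, hi, hi', him, him'] using this
  subst h1
  exact ⟨rfl, mul_right_cancel₀ (by omega : m ≠ 0) (add_left_cancel h)⟩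

/-- Translates by different multiples of `m` lie in windows sharing at most an endpoint, so a
crossing would occur within a single copy of the forest. -/
theorem IsForest.not_cross_translate {m : ℕ} {F : Finset (ℕ × ℕ)} (hF : IsForest m F)
    {p q : ℕ × ℕ} (hp : p ∈ F) (hq : q ∈ F) (c c' : ℤ) :
    ¬ (p.1 + c * m < q.1 + c' * m ∧ q.1 + c' * m < p.2 + c * m ∧ p.2 + c * m < q.2 + c' * m) := by
  rintro ⟨h1, h2, h3⟩
  have hp1 := hF.1 p hp
  have hq1 := hF.1 q hq
  have step : ∀ a b : ℤ, a < b → a * m + m ≤ b * m := fun a b hab => by nlinarith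
  rcases lt_trichotomy c c' with h | h | h
  · have := step _ _ h
    omega
  · subst h
    exact hF.2 p hp q hq ⟨by omega, by omega, by omega⟩
  · have := step _ _ h
    omega

section Periodic

variable {n : ℕ} [NeZero n]

/-- `D` is mapped to itself by the rotation by `r` steps. -/
def IsPeriodic (r : ℤ) (D : Finset (Sym2 (Fin n))) : Prop :=
  ∀ i j : ℤ, s(vtx n i, vtx n j) ∈ D ↔ s(vtx n (i + r), vtx n (j + r)) ∈ D

theorem IsPeriodic.mul {r : ℤ} {D : Finset (Sym2 (Fin n))} (h : IsPeriodic r D) (c : ℤ) :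
    IsPeriodic (c * r) D := by
  induction c using Int.induction_on with
  | zero => intro i j; simp
  | succ k ih =>
    intro i j
    rw [ih i j, h]
    ring_nf
  | pred k ih =>
    intro i j
    rw [ih i j, h (i + (-(k : ℤ) - 1) * r)]
    ring_nf

/-- The vertex `v` lies strictly below no arc of `D` of length at most `m`. -/
def IsExposedVtx (m : ℕ) (D : Finset (Sym2 (Fin n))) (v : ℤ) : Prop :=
  ∀ i j : ℤ, i < v → v < j → j ≤ i + m → s(vtx n i, vtx n j) ∉ D

/-- `D` does not contain a chord joining vertices that are `m = n / d` steps apart if `d = 2`. -/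
def NoDiameter (d m : ℕ) (D : Finset (Sym2 (Fin n))) : Prop :=
  d = 2 → ∀ i : ℤ, s(vtx n i, vtx n (i + m)) ∉ D

open Classical in
/-- The arcs of `D` within the window of length `m` starting at `v`. -/
noncomputable def windowArcs (m : ℕ) (D : Finset (Sym2 (Fin n))) (v : ℤ) : Finset (ℕ × ℕ) :=
  (Finset.range (m + 1) ×ˢ Finset.range (m + 1)).filter fun p =>
    p.1 + 2 ≤ p.2 ∧ s(vtx n (v + p.1), vtx n (v + p.2)) ∈ D

theorem mem_windowArcs {m : ℕ} {D : Finset (Sym2 (Fin n))} {v : ℤ} {p : ℕ × ℕ} :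
    p ∈ windowArcs m D v ↔
      p.2 ≤ m ∧ p.1 + 2 ≤ p.2 ∧ s(vtx n (v + p.1), vtx n (v + p.2)) ∈ D := by
  simp only [windowArcs, Finset.mem_filter, Finset.mem_product, Finset.mem_range]
  constructor
  · rintro ⟨h1, h2, h3⟩
    exact ⟨by omega, h2, h3⟩
  · rintro ⟨h1, h2, h3⟩
    exact ⟨by omega, h2, h3⟩

/-- The `d` translates by multiples of `m` of the arcs of `F`, placed at the vertex `v`. -/
def unroll (n : ℕ) [NeZero n] (d m : ℕ) (v : ℤ) (F : Finset (ℕ × ℕ)) : Finset (Sym2 (Fin n)) :=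
  (F ×ˢ Finset.range d).image fun q =>
    s(vtx n (v + q.1.1 + (q.2 : ℤ) * m), vtx n (v + q.1.2 + (q.2 : ℤ) * m))

variable {d m : ℕ}

/-- A chord other than a diameter has at most one representation as a short arc, up to
translation by `n`. -/
theorem exists_translate_of_mk_eq (hn : n = d * m) (hd : 2 ≤ d) {a b a' b' : ℤ} (hab : a < b)
    (hb : b ≤ a + m) (hab' : a' < b') (hb' : b' ≤ a' + m) (hne : d = 2 → b ≠ a + m)
    (h : s(vtx n a, vtx n b) = s(vtx n a', vtx n b')) :
    ∃ c : ℤ, a' = a + c * n ∧ b' = b + c * n := by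
  have h2 : 2 * (m : ℤ) ≤ n := by rw [hn]; push_cast; nlinarith
  have h3 : d ≠ 2 → 3 * (m : ℤ) ≤ n := by
    intro h; rw [hn]; push_cast
    have : (3 : ℤ) ≤ d := by omega
    nlinarith
  rcases Sym2.eq_iff.1 h with ⟨h1, h1'⟩ | ⟨h1, h1'⟩
  · obtain ⟨c, rfl⟩ := vtx_eq_iff.1 h1
    refine ⟨c, rfl, ?_⟩
    exact eq_of_vtx_eq (by rw [← h1', vtx_add_mul]) (by omega) (by omega)
  · obtain ⟨c, rfl⟩ := vtx_eq_iff.1 h1'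
    exfalso
    -- With opposite orientations the two arcs together go once round the polygon. Their lengths,
    -- each at most `m`, would sum to `n`, which forces `d = 2` and a diameter.
    have : b' = a + n + c * n := by
      by_cases hbm : d = 2
      · have := hne hbm
        exact eq_of_vtx_eq (by rw [← h1, vtx_add_mul, vtx_add_n]) (by omega) (by omega)
      · have := h3 hbm
        exact eq_of_vtx_eq (by rw [← h1, vtx_add_mul, vtx_add_n]) (by omega) (by omega)
    by_cases hbm : d = 2
    · have := hne hbm
      omega
    · have := h3 hbm
      omega

theorem mk_mem_unroll_of_mem (hn : n = d * m) {v : ℤ} {F : Finset (ℕ × ℕ)} {p : ℕ × ℕ}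
    (hp : p ∈ F) (c : ℤ) :
    s(vtx n (v + p.1 + c * m), vtx n (v + p.2 + c * m)) ∈ unroll n d m v F := by
  have hpos := natCast_pos_of_neZero n
  have hd : (0 : ℤ) < d := by
    rcases Nat.eq_zero_or_pos d with h | h
    · rw [hn, h] at hpos; simp at hpos
    · exact_mod_cast h
  have hc := Int.emod_nonneg c hd.ne'
  refine Finset.mem_image.2 ⟨(p, (c % d).toNat), ?_, ?_⟩
  · have := Int.emod_lt_of_pos c hd
    simp only [Finset.mem_product, Finset.mem_range]
    exact ⟨hp, by omega⟩
  · simp only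
    rw [Int.toNat_of_nonneg hc]
    have key : ∀ x : ℤ, vtx n (x + c % d * m) = vtx n (x + c * m) := by
      intro x
      refine vtx_eq_iff.2 ⟨c / d, ?_⟩
      have := Int.emod_add_mul_ediv c d
      rw [hn]
      push_cast
      linear_combination -(m : ℤ) * this
    rw [key, key]

theorem exists_of_mem_unroll {v : ℤ} {F : Finset (ℕ × ℕ)} {e : Sym2 (Fin n)}
    (h : e ∈ unroll n d m v F) :
    ∃ p ∈ F, ∃ c : ℤ, e = s(vtx n (v + p.1 + c * m), vtx n (v + p.2 + c * m)) := by
  obtain ⟨⟨p, c⟩, h1, rfl⟩ := Finset.mem_image.1 h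
  exact ⟨p, (Finset.mem_product.1 h1).1, c, rfl⟩

theorem IsForest.mk_mem_unroll_iff {F : Finset (ℕ × ℕ)} (hF : IsForest m F) (hn : n = d * m)
    (hd : 2 ≤ d) (h0 : d = 2 → (0, m) ∉ F) {v a b : ℤ} (hab : a < b) (hb : b ≤ a + m) :
    s(vtx n a, vtx n b) ∈ unroll n d m v F ↔
      ∃ p ∈ F, ∃ c : ℤ, a = v + p.1 + c * m ∧ b = v + p.2 + c * m := by
  constructor
  · intro h
    obtain ⟨p, hp, c, he⟩ := exists_of_mem_unroll h
    have hp1 := hF.1 p hp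
    obtain ⟨t, ht, ht'⟩ := exists_translate_of_mk_eq hn hd (by omega) (by omega) hab hb (by
      intro h2 h3
      refine h0 h2 ?_
      have : p = (0, m) := Prod.ext (by simp only; omega) (by simp only; omega)
      rwa [← this]) he.symm
    refine ⟨p, hp, c + t * d, ?_, ?_⟩
    · rw [ht, hn]; push_cast; ring
    · rw [ht', hn]; push_cast; ring
  · rintro ⟨p, hp, c, rfl, rfl⟩
    exact mk_mem_unroll_of_mem hn hp c

/-- The `d` translates of an arc are distinct chords, except that for `d = 2` both translates of
`(0, m)` are the same diameter. -/
theorem IsForest.card_unroll {F : Finset (ℕ × ℕ)} (hF : IsForest m F) (hn : n = d * m)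
    (hd : 2 ≤ d) (h0 : d = 2 → (0, m) ∉ F) (v : ℤ) : (unroll n d m v F).card = d * F.card := by
  unfold unroll
  rw [Finset.card_image_of_injOn, Finset.card_product, Finset.card_range, mul_comm]
  rintro ⟨p, c⟩ hp ⟨q, c'⟩ hq he
  simp only [Finset.coe_product, Set.mem_prod, Finset.mem_coe, Finset.mem_range] at hp hq
  simp only at he
  have hp1 := hF.1 p hp.1
  have hq1 := hF.1 q hq.1
  obtain ⟨t, ht, ht'⟩ := exists_translate_of_mk_eq hn hd (by omega) (by omega) (by omega)
    (by omega) (by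
      intro h2 h3
      refine h0 h2 ?_
      have : p = (0, m) := Prod.ext (by simp only; omega) (by simp only; omega)
      rw [← this]; exact hp.1) he
  have e1 : (q.1 : ℤ) + c' * m = p.1 + (c + t * d) * m := by
    rw [hn] at ht; push_cast at ht; linear_combination ht
  obtain ⟨e2, e3⟩ := eq_of_add_mul_eq e1 (by omega) (by omega) (by omega) (by omega)
  have e4 := (eq_of_add_mul_eq (m := (d : ℤ)) (i := c') (c := 0) (i' := c) (c' := t)
    (by linarith) (by omega) (by omega) (by omega) (by omega)).1
  have e5 : q.2 = p.2 := by
    have : (v + q.2 + c' * m) - (v + q.1 + c' * m) = (v + p.2 + c * m) - (v + p.1 + c * m) := by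
      rw [ht, ht']; ring
    omega
  rw [Prod.mk.injEq, Prod.ext_iff]
  omega

theorem isPeriodic_unroll (hn : n = d * m) (v : ℤ) (F : Finset (ℕ × ℕ)) :
    IsPeriodic m (unroll n d m v F) := by
  have key : ∀ i j t : ℤ, s(vtx n i, vtx n j) ∈ unroll n d m v F →
      s(vtx n (i + t * m), vtx n (j + t * m)) ∈ unroll n d m v F := by
    intro i j t h
    obtain ⟨p, hp, c, he⟩ := exists_of_mem_unroll h
    have hm := mk_mem_unroll_of_mem (v := v) hn hp (c + t)
    have shift : ∀ x y : ℤ, vtx n x = vtx n y → vtx n (x + t * m) = vtx n (y + t * m) := by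
      intro x y hxy
      obtain ⟨u, rfl⟩ := vtx_eq_iff.1 hxy
      exact vtx_eq_iff.2 ⟨u, by ring⟩
    have e1 : ∀ x : ℤ, v + x + (c + t) * m = v + x + c * m + t * m := fun x => by ring
    rw [e1, e1] at hm
    rcases Sym2.eq_iff.1 he with ⟨h1, h2⟩ | ⟨h1, h2⟩
    · rwa [shift _ _ h1, shift _ _ h2]
    · rwa [shift _ _ h1, shift _ _ h2, Sym2.eq_swap]
  intro i j
  constructor
  · intro h
    simpa using key i j 1 h
  · intro h
    simpa using key _ _ (-1) h

theorem IsForest.isDissection_unroll {F : Finset (ℕ × ℕ)} (hF : IsForest m F) (hn : n = d * m)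
    (hd : 2 ≤ d) (v : ℤ) : IsDissection n (unroll n d m v F) := by
  have h2 : 2 * (m : ℤ) ≤ n := by rw [hn]; push_cast; nlinarith
  constructor
  · intro e he
    obtain ⟨p, hp, c, rfl⟩ := exists_of_mem_unroll he
    have := hF.1 p hp
    rw [isDiagonal_vtx_iff (by omega) (by omega)]
    omega
  · intro e he f hf hcr
    obtain ⟨p, hp, c, rfl⟩ := exists_of_mem_unroll he
    obtain ⟨q, hq, c', rfl⟩ := exists_of_mem_unroll hf
    have hp1 := hF.1 p hp
    have hq1 := hF.1 q hq
    obtain ⟨x, y, h3, h4, h5, h6, h7⟩ := hcr.exists_vtx (by omega) (by omega)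
    have hpn := natCast_pos_of_neZero n
    rcases Sym2.eq_iff.1 h7 with ⟨h8, h9⟩ | ⟨h8, h9⟩
    · obtain ⟨t, rfl⟩ := vtx_eq_iff.1 h8
      have hy : y = v + q.2 + c' * m + t * n :=
        eq_of_vtx_eq (by rw [← h9, vtx_add_mul]) (by omega) (by omega)
      have e : t * (n : ℤ) = (t * d) * m := by rw [hn]; push_cast; ring
      refine hF.not_cross_translate hp hq c (c' + t * d) ?_
      rw [add_mul, ← e]
      omega
    · obtain ⟨t, rfl⟩ := vtx_eq_iff.1 h8
      have hx : x + n = v + q.2 + c' * m + t * n :=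
        eq_of_vtx_eq (by rw [vtx_add_n, ← h9, vtx_add_mul]) (by omega) (by omega)
      have e : t * (n : ℤ) = (t * d) * m := by rw [hn]; push_cast; ring
      have e' : (n : ℤ) = d * m := by rw [hn]; push_cast; ring
      refine hF.not_cross_translate hq hp (c' + t * d) (c + d) ?_
      rw [add_mul, add_mul, ← e, ← e']
      omega

theorem IsForest.isExposedVtx_unroll_iff {F : Finset (ℕ × ℕ)} (hF : IsForest m F) (hn : n = d * m)
    (hd : 2 ≤ d) (h0 : d = 2 → (0, m) ∉ F) (v : ℤ) {u : ℕ} (hu : u < m) (c : ℤ) :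
    IsExposedVtx m (unroll n d m v F) (v + u + c * m) ↔ u ∈ uncovered m F := by
  rw [mem_uncovered]
  constructor
  · intro h
    refine ⟨hu, fun p hp hpu => ?_⟩
    have := hF.1 p hp
    exact h _ _ (by omega) (by omega) (by omega) (mk_mem_unroll_of_mem hn hp c)
  · rintro ⟨-, h⟩ i j h1 h2 h3 h4
    obtain ⟨p, hp, c', rfl, rfl⟩ := (hF.mk_mem_unroll_iff hn hd h0 (by omega) h3).1 h4
    have := hF.1 p hp
    have step : ∀ a b : ℤ, a < b → a * m + m ≤ b * m := fun a b hab => by nlinarith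
    rcases lt_trichotomy c c' with h5 | h5 | h5
    · have := step _ _ h5
      omega
    · subst h5
      exact h p hp (by omega)
    · have := step _ _ h5
      omega

theorem IsForest.isExposedVtx_unroll {F : Finset (ℕ × ℕ)} (hF : IsForest m F) (hn : n = d * m)
    (hd : 2 ≤ d) (h0 : d = 2 → (0, m) ∉ F) (v : ℤ) : IsExposedVtx m (unroll n d m v F) v := by
  have hm : 0 < m := by
    rcases Nat.eq_zero_or_pos m with h | h
    · exact absurd (by rw [hn, h, mul_zero]) (NeZero.ne n)
    · exact h
  simpa using (hF.isExposedVtx_unroll_iff hn hd h0 v hm 0).2 (zero_mem_uncovered hm F)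

theorem IsForest.noDiameter_unroll {F : Finset (ℕ × ℕ)} (hF : IsForest m F) (hn : n = d * m)
    (hd : 2 ≤ d) (h0 : d = 2 → (0, m) ∉ F) (v : ℤ) : NoDiameter d m (unroll n d m v F) := by
  intro h2 i h
  have hm : 0 < m := by
    rcases Nat.eq_zero_or_pos m with h | h
    · exact absurd (by rw [hn, h, mul_zero]) (NeZero.ne n)
    · exact h
  obtain ⟨p, hp, c, h3, h4⟩ := (hF.mk_mem_unroll_iff hn hd h0 (by omega) le_rfl).1 h
  have := hF.1 p hp
  refine h0 h2 ?_
  have : p = (0, m) := Prod.ext (by simp only; omega) (by simp only; omega)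
  rwa [← this]

theorem IsForest.windowArcs_unroll {F : Finset (ℕ × ℕ)} (hF : IsForest m F) (hn : n = d * m)
    (hd : 2 ≤ d) (h0 : d = 2 → (0, m) ∉ F) (v : ℤ) : windowArcs m (unroll n d m v F) v = F := by
  ext q
  rw [mem_windowArcs]
  constructor
  · rintro ⟨h1, h2, h3⟩
    obtain ⟨p, hp, c, h4, h5⟩ := (hF.mk_mem_unroll_iff hn hd h0 (by omega) (by omega)).1 h3
    have hp1 := hF.1 p hp
    obtain ⟨h6, rfl⟩ := eq_of_add_mul_eq (m := (m : ℤ)) (i := q.1) (c := 0) (i' := p.1) (c' := c)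
      (by linarith) (by omega) (by omega) (by omega) (by omega)
    have : q = p := Prod.ext (by omega) (by omega)
    rwa [this]
  · intro hq
    have hq1 := hF.1 q hq
    have := mk_mem_unroll_of_mem (v := v) hn hq 0
    simp only [zero_mul, add_zero] at this
    exact ⟨hq1.2, hq1.1, this⟩

theorem IsDissection.isForest_windowArcs {D : Finset (Sym2 (Fin n))} (hD : IsDissection n D)
    (hn : n = d * m) (hd : 2 ≤ d) (v : ℤ) : IsForest m (windowArcs m D v) := by
  have h2 : 2 * (m : ℤ) ≤ n := by rw [hn]; push_cast; nlinarith
  have hpn := natCast_pos_of_neZero n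
  constructor
  · intro p hp
    rw [mem_windowArcs] at hp
    exact ⟨hp.2.1, hp.1⟩
  · rintro p hp q hq ⟨h3, h4, h5⟩
    rw [mem_windowArcs] at hp hq
    exact hD.2 _ hp.2.2 _ hq.2.2 (crosses_vtx (by omega) (by omega) (by omega) (by omega))

theorem NoDiameter.zero_not_mem_windowArcs {D : Finset (Sym2 (Fin n))} (hD : NoDiameter d m D)
    (v : ℤ) (h : d = 2) : (0, m) ∉ windowArcs m D v := by
  rw [mem_windowArcs]
  intro h1
  exact hD h v (by simpa using h1.2.2)

/-- Chords longer than `m` both ways would cross their rotated copies. -/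
theorem IsDissection.exists_short {D : Finset (Sym2 (Fin n))} (hD : IsDissection n D)
    (hper : IsPeriodic m D) (hm : 0 < (m : ℤ)) {e : Sym2 (Fin n)} (he : e ∈ D) :
    ∃ i j : ℤ, i + 2 ≤ j ∧ j ≤ i + m ∧ e = s(vtx n i, vtx n j) := by
  obtain ⟨i, j, -, h1, -, h2, rfl⟩ := (hD.1 e he).exists_vtx 0
  rcases le_or_gt j (i + m) with h3 | h3
  · exact ⟨i, j, h1, h3, rfl⟩
  rcases le_or_gt (i + n) (j + m) with h4 | h4
  · exact ⟨j, i + n, by omega, h4, by rw [vtx_add_n, Sym2.eq_swap]⟩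
  · exact absurd (crosses_vtx (by omega) h3 (by omega) (by omega))
      (hD.2 _ he _ ((hper i j).1 he))

theorem IsPeriodic.isExposedVtx_add_mul {D : Finset (Sym2 (Fin n))} (hper : IsPeriodic m D)
    {v : ℤ} (hv : IsExposedVtx m D v) (c : ℤ) : IsExposedVtx m D (v + c * m) := by
  intro i j h1 h2 h3 h4
  refine hv (i - c * m) (j - c * m) (by omega) (by omega) (by omega) ?_
  rw [hper.mul c]
  simpa using h4

/-- Every chord is a short arc, and by periodicity all translates of `v` by multiples of `m` are
exposed. Hence no short arc passes over one, and each lies within a single window. -/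
theorem IsDissection.unroll_windowArcs {D : Finset (Sym2 (Fin n))} (hD : IsDissection n D)
    (hper : IsPeriodic m D) (hn : n = d * m) {v : ℤ} (hv : IsExposedVtx m D v) :
    unroll n d m v (windowArcs m D v) = D := by
  have hm : 0 < (m : ℤ) := by
    rcases Nat.eq_zero_or_pos m with h | h
    · exact absurd (by rw [hn, h, mul_zero]) (NeZero.ne n)
    · exact_mod_cast h
  ext e
  constructor
  · intro he
    obtain ⟨p, hp, c, rfl⟩ := exists_of_mem_unroll he
    rw [mem_windowArcs] at hp
    exact (hper.mul c _ _).1 hp.2.2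
  · intro he
    obtain ⟨i, j, h1, h2, rfl⟩ := hD.exists_short hper hm he
    set c := (i - v) / m with hc
    have h3 := Int.emod_add_mul_ediv (i - v) m
    have h4 := Int.emod_nonneg (i - v) hm.ne'
    have h5 := Int.emod_lt_of_pos (i - v) hm
    rw [← hc, mul_comm] at h3
    have h6 : j ≤ v + (c + 1) * m := by
      by_contra h
      refine hper.isExposedVtx_add_mul hv (c + 1) i j ?_ (by omega) h2 he
      rw [add_mul]
      omega
    rw [add_mul] at h6
    have e1 : ∀ x : ℤ, v + (x - v - c * m) + c * m = x := fun x => by ring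
    have hw : ((i - v - c * m).toNat, (j - v - c * m).toNat) ∈ windowArcs m D v := by
      rw [mem_windowArcs]
      refine ⟨by omega, by simp only; omega, ?_⟩
      rw [hper.mul c]
      simp only
      rw [Int.toNat_of_nonneg (by omega), Int.toNat_of_nonneg (by omega)]
      rwa [e1, e1]
    have := mk_mem_unroll_of_mem (v := v) hn hw c
    simp only at this
    rw [Int.toNat_of_nonneg (by omega), Int.toNat_of_nonneg (by omega)] at this
    rwa [e1, e1] at this

/-- The right end of a longest short arc is exposed: a short arc over it would be even longer or
would cross it. -/
theorem IsDissection.exists_isExposedVtx {D : Finset (Sym2 (Fin n))} (hD : IsDissection n D)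
    (hn : n = d * m) (hd : 2 ≤ d) : ∃ a : Fin n, IsExposedVtx m D a.val := by
  classical
  have h2 : 2 * (m : ℤ) ≤ n := by rw [hn]; push_cast; nlinarith
  have hm : 0 < (m : ℤ) := by
    rcases Nat.eq_zero_or_pos m with h | h
    · exact absurd (by rw [hn, h, mul_zero]) (NeZero.ne n)
    · exact_mod_cast h
  suffices h : ∃ v : ℤ, IsExposedVtx m D v by
    obtain ⟨v, hv⟩ := h
    refine ⟨vtx n v, ?_⟩
    obtain ⟨c, hc⟩ := vtx_eq_iff.1 (vtx_coe (vtx n v))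
    intro i j h3 h4 h5 h6
    refine hv (i + c * n) (j + c * n) (by omega) (by omega) (by omega) ?_
    rwa [vtx_add_mul, vtx_add_mul]
  set S := ((Finset.univ : Finset (Fin n)) ×ˢ Finset.range (m + 1)).filter fun q =>
    0 < q.2 ∧ s(vtx n q.1.val, vtx n (q.1.val + q.2)) ∈ D with hS
  have memS : ∀ i j : ℤ, i < j → j ≤ i + m → s(vtx n i, vtx n j) ∈ D →
      (vtx n i, (j - i).toNat) ∈ S := by
    intro i j h3 h4 h5
    simp only [hS, Finset.mem_filter, Finset.mem_product, Finset.mem_univ, Finset.mem_range,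
      true_and]
    refine ⟨by omega, by omega, ?_⟩
    obtain ⟨c, hc⟩ := vtx_eq_iff.1 (vtx_coe (vtx n i))
    have e : vtx n ((vtx n i).val + (j - i)) = vtx n j := by
      rw [← vtx_add_mul _ c]
      congr 1
      omega
    rwa [vtx_coe, Int.toNat_of_nonneg (by omega), e]
  rcases S.eq_empty_or_nonempty with h | h
  · refine ⟨0, fun i j h3 h4 h5 h6 => ?_⟩
    have := memS i j (by omega) h5 h6
    rw [h] at this
    simp at this
  · obtain ⟨⟨a, l⟩, hal, hmax⟩ := S.exists_max_image Prod.snd h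
    simp only [hS, Finset.mem_filter, Finset.mem_product, Finset.mem_univ, Finset.mem_range,
      true_and] at hal
    refine ⟨a.val + l, fun i j h3 h4 h5 h6 => ?_⟩
    have := hmax _ (memS i j (by omega) h5 h6)
    simp only at this
    rcases le_or_gt i a.val with h7 | h7
    · omega
    · exact hD.2 _ hal.2.2 _ h6 (crosses_vtx h7 h3 h4 (by omega))

open Classical in
/-- The vertices exposed by `D`. -/
noncomputable def exposedVtxs (m : ℕ) (D : Finset (Sym2 (Fin n))) : Finset (Fin n) :=
  Finset.univ.filter fun a => IsExposedVtx m D a.val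

theorem isExposedVtx_val_vtx {D : Finset (Sym2 (Fin n))} {v : ℤ} :
    IsExposedVtx m D (vtx n v).val ↔ IsExposedVtx m D v := by
  have key : ∀ (x c : ℤ), IsExposedVtx m D x → IsExposedVtx m D (x + c * n) := by
    intro x c h i j h3 h4 h5 h6
    refine h (i + (-c) * n) (j + (-c) * n) (by rw [neg_mul]; omega) (by rw [neg_mul]; omega)
      (by omega) ?_
    rwa [vtx_add_mul, vtx_add_mul]
  obtain ⟨c, hc⟩ := vtx_eq_iff.1 (vtx_coe (vtx n v))
  constructor
  · intro h
    rw [hc]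
    exact key _ _ h
  · intro h
    have := key _ (-c) h
    rwa [show v + -c * n = (vtx n v).val by rw [neg_mul]; omega] at this

theorem IsForest.card_exposedVtxs_unroll {F : Finset (ℕ × ℕ)} (hF : IsForest m F) (hn : n = d * m)
    (hd : 2 ≤ d) (h0 : d = 2 → (0, m) ∉ F) (v : ℤ) :
    (exposedVtxs m (unroll n d m v F)).card = d * (uncovered m F).card := by
  have hm : 0 < (m : ℤ) := by
    rcases Nat.eq_zero_or_pos m with h | h
    · exact absurd (by rw [hn, h, mul_zero]) (NeZero.ne n)
    · exact_mod_cast h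
  have hcard : d * (uncovered m F).card = (uncovered m F ×ˢ Finset.range d).card := by
    rw [Finset.card_product, Finset.card_range, mul_comm]
  rw [hcard]
  symm
  refine Finset.card_bij (fun q _ => vtx n (v + q.1 + (q.2 : ℤ) * m)) ?_ ?_ ?_
  · rintro ⟨u, c⟩ hq
    simp only [Finset.mem_product, Finset.mem_range, exposedVtxs, Finset.mem_filter,
      Finset.mem_univ, true_and] at hq ⊢
    rw [isExposedVtx_val_vtx]
    exact (hF.isExposedVtx_unroll_iff hn hd h0 v (mem_uncovered.1 hq.1).1 c).2 hq.1
  · rintro ⟨u, c⟩ hq ⟨u', c'⟩ hq' he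
    simp only [Finset.mem_product, Finset.mem_range] at hq hq' he
    have hu := (mem_uncovered.1 hq.1).1
    have hu' := (mem_uncovered.1 hq'.1).1
    obtain ⟨t, ht⟩ := vtx_eq_iff.1 he
    have e1 : (u' : ℤ) + c' * m = u + (c + t * d) * m := by
      rw [hn] at ht; push_cast at ht; linear_combination ht
    obtain ⟨e2, e3⟩ := eq_of_add_mul_eq e1 (by omega) (by omega) (by omega) (by omega)
    have e4 := (eq_of_add_mul_eq (m := (d : ℤ)) (i := c') (c := 0) (i' := c) (c' := t)
      (by linarith) (by omega) (by omega) (by omega) (by omega)).1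
    rw [Prod.mk.injEq]
    omega
  · intro a ha
    simp only [exposedVtxs, Finset.mem_filter, Finset.mem_univ, true_and] at ha
    obtain ⟨i, h1, h2, rfl⟩ := exists_vtx_eq a v
    rw [isExposedVtx_val_vtx] at ha
    have h3 := Int.emod_add_mul_ediv (i - v) m
    have h4 := Int.emod_nonneg (i - v) hm.ne'
    have h5 := Int.emod_lt_of_pos (i - v) hm
    have h6 : 0 ≤ (i - v) / m := Int.ediv_nonneg (by omega) hm.le
    have h7 : (i - v) / m < d := Int.ediv_lt_of_lt_mul hm (by
      have : (n : ℤ) = d * m := by rw [hn]; push_cast; ring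
      omega)
    have h8 : i = v + ((i - v) % m).toNat + (((i - v) / m).toNat : ℤ) * m := by
      rw [Int.toNat_of_nonneg h4, Int.toNat_of_nonneg h6]
      linarith
    refine ⟨(((i - v) % m).toNat, ((i - v) / m).toNat), ?_, by rw [← h8]⟩
    rw [h8] at ha
    simp only [Finset.mem_product, Finset.mem_range]
    exact ⟨(hF.isExposedVtx_unroll_iff hn hd h0 v (by omega) _).1 ha, by omega⟩

end Periodic

/-! ### Counting dissections with a given symmetry -/

section Counting

variable {n : ℕ} [NeZero n] {d m : ℕ}

open Classical in
/-- The dissections of the `n`-gon with `k` diagonals that are invariant under rotation by `m`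
steps. -/
noncomputable def periodicDissections (n : ℕ) [NeZero n] (m k : ℕ) :
    Finset (Finset (Sym2 (Fin n))) :=
  Finset.univ.filter fun D => IsDissection n D ∧ IsPeriodic m D ∧ D.card = k

theorem mem_periodicDissections {k : ℕ} {D : Finset (Sym2 (Fin n))} :
    D ∈ periodicDissections n m k ↔ IsDissection n D ∧ IsPeriodic m D ∧ D.card = k := by
  simp [periodicDissections]

/-- Vertex `0` is always uncovered, so threshold `0` imposes nothing; threshold `1` rules out
exactly the diameter arc. -/
theorem IsForest.lt_card_uncovered_iff (hm : 0 < m) (hm2 : d = 2 → 2 ≤ m) {F : Finset (ℕ × ℕ)}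
    (hF : IsForest m F) :
    (if d = 2 then 1 else 0) < (uncovered m F).card ↔ (d = 2 → (0, m) ∉ F) := by
  split_ifs with h
  · rw [hF.one_lt_card_uncovered_iff (hm2 h)]
    simp [h]
  · simp only [h, false_imp_iff, iff_true]
    exact Finset.card_pos.2 ⟨0, zero_mem_uncovered hm F⟩

open Classical in
/-- Counting pairs of a periodic dissection and an exposed vertex. -/
theorem card_periodicDissections_noDiameter (hn : n = d * m) (hd : 2 ≤ d) (hm2 : d = 2 → 2 ≤ m)
    (k : ℕ) :
    (((periodicDissections n m (d * k)).filter (NoDiameter d m)).card : ℚ) =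
      m * forestWeight m (if d = 2 then 1 else 0) k := by
  have hm : 0 < m := by
    rcases Nat.eq_zero_or_pos m with h | h
    · exact absurd (by rw [hn, h, mul_zero]) (NeZero.ne n)
    · exact h
  set S := (periodicDissections n m (d * k)).filter (NoDiameter d m) with hS
  have memS : ∀ D, D ∈ S ↔
      (IsDissection n D ∧ IsPeriodic m D ∧ D.card = d * k) ∧ NoDiameter d m D := by
    intro D
    rw [hS, Finset.mem_filter, mem_periodicDissections]
  -- Each dissection spreads a unit weight evenly over its exposed vertices, of which there is at
  -- least one.
  have h1 : ∀ D ∈ S, (1 : ℚ) = ∑ a : Fin n,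
      if IsExposedVtx m D a.val then ((exposedVtxs m D).card : ℚ)⁻¹ else 0 := by
    intro D hD
    obtain ⟨a, ha⟩ := ((memS D).1 hD).1.1.exists_isExposedVtx hn hd
    rw [← Finset.sum_filter, Finset.sum_const, nsmul_eq_mul]
    have hpos : 0 < (exposedVtxs m D).card := Finset.card_pos.2 ⟨a, by simp [exposedVtxs, ha]⟩
    exact (mul_inv_cancel₀ (by exact_mod_cast hpos.ne')).symm
  -- For a fixed exposed vertex, cutting and unrolling are inverse bijections with forests; the
  -- `d`-fold count of exposed vertices supplies the factor `1 / d`.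
  have h2 : ∀ a : Fin n, (∑ D ∈ S,
      if IsExposedVtx m D a.val then ((exposedVtxs m D).card : ℚ)⁻¹ else 0) =
      (d : ℚ)⁻¹ * forestWeight m (if d = 2 then 1 else 0) k := by
    intro a
    rw [← Finset.sum_filter, forestWeight, Finset.mul_sum]
    symm
    have memT : ∀ F, F ∈ (forests m k).filter
        (fun F => (if d = 2 then 1 else 0) < (uncovered m F).card) ↔
        IsForest m F ∧ F.card = k ∧ (d = 2 → (0, m) ∉ F) := by
      intro F
      rw [Finset.mem_filter, mem_forests, and_assoc]
      refine and_congr_right fun hF => and_congr_right fun _ => hF.lt_card_uncovered_iff hm hm2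
    refine Finset.sum_bij' (fun F _ => unroll n d m a.val F) (fun D _ => windowArcs m D a.val)
      ?_ ?_ ?_ ?_ ?_
    · intro F hF
      obtain ⟨hF, hk, h0⟩ := (memT F).1 hF
      rw [Finset.mem_filter, memS]
      exact ⟨⟨⟨hF.isDissection_unroll hn hd _, isPeriodic_unroll hn _ _,
        by rw [hF.card_unroll hn hd h0, hk]⟩, hF.noDiameter_unroll hn hd h0 _⟩,
        hF.isExposedVtx_unroll hn hd h0 _⟩
    · intro D hD
      rw [Finset.mem_filter, memS] at hD
      obtain ⟨⟨⟨hD, hper, hk⟩, h0⟩, hv⟩ := hD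
      have hF := hD.isForest_windowArcs hn hd a.val
      have h0' := h0.zero_not_mem_windowArcs a.val
      refine (memT _).2 ⟨hF, ?_, h0'⟩
      have := hF.card_unroll hn hd h0' a.val
      rw [hD.unroll_windowArcs hper hn hv, hk] at this
      exact (Nat.eq_of_mul_eq_mul_left (by omega) this).symm
    · intro F hF
      obtain ⟨hF, hk, h0⟩ := (memT F).1 hF
      exact hF.windowArcs_unroll hn hd h0 _
    · intro D hD
      rw [Finset.mem_filter, memS] at hD
      obtain ⟨⟨⟨hD, hper, hk⟩, h0⟩, hv⟩ := hD
      exact hD.unroll_windowArcs hper hn hv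
    · intro F hF
      obtain ⟨hF, hk, h0⟩ := (memT F).1 hF
      rw [hF.card_exposedVtxs_unroll hn hd h0, Nat.cast_mul, mul_inv]
  rw [Finset.card_eq_sum_ones, Nat.cast_sum, Nat.cast_one, Finset.sum_congr rfl h1,
    Finset.sum_comm, Finset.sum_congr rfl fun a _ => h2 a, Finset.sum_const, Finset.card_univ,
    Fintype.card_fin, nsmul_eq_mul, ← mul_assoc]
  congr 1
  have : (d : ℚ) ≠ 0 := by positivity
  have e : (n : ℚ) = d * m := by rw [hn]; push_cast; ring
  rw [e]
  field_simp

theorem IsDissection.dvd_card {D : Finset (Sym2 (Fin n))} (hD : IsDissection n D)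
    (hper : IsPeriodic m D) (hn : n = d * m) (hd : 2 ≤ d) (h0 : NoDiameter d m D) :
    d ∣ D.card := by
  obtain ⟨a, ha⟩ := hD.exists_isExposedVtx hn hd
  refine ⟨(windowArcs m D a.val).card, ?_⟩
  rw [← (hD.isForest_windowArcs hn hd a.val).card_unroll hn hd
    (h0.zero_not_mem_windowArcs a.val) a.val, hD.unroll_windowArcs hper hn ha]

theorem noDiameter_of_ne_two (hd : d ≠ 2) (D : Finset (Sym2 (Fin n))) : NoDiameter d m D :=
  fun h => absurd h hd

/-- A centrally symmetric dissection with a diameter has an odd number of diagonals. -/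
theorem IsDissection.noDiameter_of_even {D : Finset (Sym2 (Fin n))} (hD : IsDissection n D)
    (hper : IsPeriodic m D) (hn : n = 2 * m) (heven : Even D.card) : NoDiameter 2 m D := by
  classical
  intro _ i hi
  have hnpos := natCast_pos_of_neZero n
  have hn' : (n : ℤ) = m + m := by rw [hn]; push_cast; ring
  set e₀ := s(vtx n i, vtx n (i + m)) with he₀
  set R : Sym2 (Fin n) → Sym2 (Fin n) := Sym2.map ⇑(finRotate n ^ (m : ℤ)) with hR
  have hRv : ∀ a b, R s(vtx n a, vtx n b) = s(vtx n (a + m), vtx n (b + m)) := by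
    intro a b
    rw [hR, Sym2.map_mk, finRotate_zpow_vtx, finRotate_zpow_vtx]
  have hRR : ∀ e, R (R e) = e := by
    intro e
    obtain ⟨a, b, -, -, -, rfl⟩ := exists_eq_mk_vtx e 0
    rw [hRv, hRv, add_assoc, add_assoc, ← hn', vtx_add_n, vtx_add_n]
  have hR₀ : R e₀ = e₀ := by
    rw [he₀, hRv, add_assoc, ← hn', vtx_add_n, Sym2.eq_swap]
  -- A chord fixed by the half-turn is a diameter, and distinct diameters cross.
  have hfix : ∀ e ∈ D, R e = e → e = e₀ := by
    intro e he hRe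
    obtain ⟨a, b, h1, h2, h3, h4, rfl⟩ := (hD.1 e he).exists_vtx i
    rw [hRv] at hRe
    rcases Sym2.eq_iff.1 hRe with ⟨h5, -⟩ | ⟨h5, -⟩
    · exact absurd h5.symm (vtx_ne (by omega) (by omega))
    · have hb : b = a + m := eq_of_vtx_eq h5.symm (by omega) (by omega)
      subst hb
      rcases h1.lt_or_eq with h6 | rfl
      · exact absurd (crosses_vtx h6 (by omega) (by omega) (by omega)) (hD.2 _ hi _ he)
      · rfl
  have hRD : ∀ e ∈ D, R e ∈ D := by
    intro e he
    obtain ⟨a, b, -, -, -, rfl⟩ := exists_eq_mk_vtx e 0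
    rw [hRv]
    exact (hper a b).1 he
  -- The half-turn pairs off the remaining chords, so their number is even.
  have hsum : ∑ e ∈ D.erase e₀, (1 : ZMod 2) = 0 := by
    refine Finset.sum_involution (fun e _ => R e) ?_ ?_ ?_ ?_
    · intro _ _; decide
    · intro e he _ h
      exact (Finset.mem_erase.1 he).1 (hfix e (Finset.mem_of_mem_erase he) h)
    · intro e he
      refine Finset.mem_erase.2 ⟨fun h => (Finset.mem_erase.1 he).1 ?_,
        hRD e (Finset.mem_of_mem_erase he)⟩
      rw [← hRR e, h, hR₀]
    · intro e _
      exact hRR e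
  rw [Finset.sum_const, nsmul_one, ZMod.natCast_eq_zero_iff_even, Finset.card_erase_of_mem hi] at hsum
  have hpos : 0 < D.card := Finset.card_pos.2 ⟨_, hi⟩
  rcases heven with ⟨a, ha⟩
  rcases hsum with ⟨b, hb⟩
  omega

theorem card_periodicDissections (hn : n = d * m) (hd : 2 ≤ d) (hm2 : d = 2 → 2 ≤ m) (k : ℕ)
    (heven : d = 2 → Even (d * k)) :
    ((periodicDissections n m (d * k)).card : ℚ) =
      m * forestWeight m (if d = 2 then 1 else 0) k := by
  classical
  rw [← card_periodicDissections_noDiameter hn hd hm2, Finset.filter_true_of_mem]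
  intro D hD
  rw [mem_periodicDissections] at hD
  by_cases h : d = 2
  · subst h
    exact hD.1.noDiameter_of_even hD.2.1 hn (by rw [hD.2.2]; exact heven rfl)
  · exact noDiameter_of_ne_two h D

theorem periodicDissections_eq_empty (hn : n = d * m) (hd : 3 ≤ d) {k : ℕ} (hk : ¬ d ∣ k) :
    periodicDissections n m k = ∅ := by
  rw [Finset.eq_empty_iff_forall_notMem]
  intro D hD
  rw [mem_periodicDissections] at hD
  refine hk ?_
  rw [← hD.2.2]
  exact hD.1.dvd_card hD.2.1 hn (by omega) (noDiameter_of_ne_two (by omega) D)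

theorem isPeriodic_self (D : Finset (Sym2 (Fin n))) : IsPeriodic n D := by
  intro i j
  rw [vtx_add_n, vtx_add_n]

/-- All dissections correspond to the forests on `n` collinear vertices without the longest
possible arc. -/
theorem card_periodicDissections_self (hn : 3 ≤ n) (k : ℕ) :
    (periodicDissections n n k).card = forestCountGT (n - 1) 1 k := by
  classical
  symm
  have vtx_inj : ∀ i j : ℤ, 0 ≤ i → 0 ≤ j → i < n → j < n → vtx n i = vtx n j → i = j :=
    fun i j h1 h2 h3 h4 h => eq_of_vtx_eq h (by omega) (by omega)
  have mk_inj : ∀ i j i' j' : ℤ, 0 ≤ i → i < j → j < n → 0 ≤ i' → i' < j' → j' < n →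
      s(vtx n i, vtx n j) = s(vtx n i', vtx n j') → i = i' ∧ j = j' := by
    intro i j i' j' h1 h2 h3 h4 h5 h6 h
    rcases Sym2.eq_iff.1 h with ⟨h7, h8⟩ | ⟨h7, h8⟩
    · exact ⟨vtx_inj _ _ (by omega) (by omega) (by omega) (by omega) h7,
        vtx_inj _ _ (by omega) (by omega) (by omega) (by omega) h8⟩
    · have e1 := vtx_inj _ _ (by omega) (by omega) (by omega) (by omega) h7
      have e2 := vtx_inj _ _ (by omega) (by omega) (by omega) (by omega) h8
      omega
  set φ : ℕ × ℕ → Sym2 (Fin n) := fun p => s(vtx n p.1, vtx n p.2) with hφ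
  have φ_inj : ∀ F, IsForest (n - 1) F → ∀ G, IsForest (n - 1) G → ∀ p ∈ F, ∀ q ∈ G,
      φ p = φ q → p = q := by
    intro F hF G hG p hp q hq h
    have h1 := hF.1 p hp
    have h2 := hG.1 q hq
    have := mk_inj _ _ _ _ (by omega) (by omega) (by omega) (by omega) (by omega) (by omega) h
    exact Prod.ext (by omega) (by omega)
  unfold forestCountGT
  refine Finset.card_bij (fun F _ => F.image φ) ?_ ?_ ?_
  · intro F hF
    rw [Finset.mem_filter, mem_forests] at hF
    obtain ⟨⟨hF, hk⟩, h0⟩ := hF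
    -- The excluded arc `(0, n - 1)` is a side of the polygon; every other arc of the forest is a
    -- diagonal.
    rw [hF.one_lt_card_uncovered_iff (by omega)] at h0
    rw [mem_periodicDissections]
    refine ⟨⟨?_, ?_⟩, isPeriodic_self _, ?_⟩
    · intro e he
      obtain ⟨p, hp, rfl⟩ := Finset.mem_image.1 he
      have h1 := hF.1 p hp
      have : ¬ (p.1 = 0 ∧ p.2 = n - 1) := by
        rintro ⟨h2, h3⟩
        exact h0 (by rwa [← h2, ← h3])
      rw [hφ]
      simp only
      rw [isDiagonal_vtx_iff (by omega) (by omega)]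
      omega
    · intro e he f hf hcr
      obtain ⟨p, hp, rfl⟩ := Finset.mem_image.1 he
      obtain ⟨q, hq, rfl⟩ := Finset.mem_image.1 hf
      have h1 := hF.1 p hp
      have h2 := hF.1 q hq
      obtain ⟨x, y, h3, h4, h5, h6, h7⟩ := hcr.exists_vtx (by omega) (by omega)
      rcases lt_or_ge y n with h8 | h8
      · have := mk_inj _ _ _ _ (by omega) (by omega) (by omega) (by omega) (by omega) h8 h7
        exact hF.2 p hp q hq (by omega)
      · have e : vtx n y = vtx n (y - n) := by
          rw [← vtx_add_n (y - n), sub_add_cancel]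
        rw [e, Sym2.eq_swap (a := vtx n x)] at h7
        have := mk_inj _ _ _ _ (by omega) (by omega) (by omega) (by omega) (by omega) (by omega) h7
        exact hF.2 q hq p hp (by omega)
    · rw [Finset.card_image_of_injOn, hk]
      intro p hp q hq h
      exact φ_inj F hF F hF p hp q hq h
  · intro F hF G hG h
    rw [Finset.mem_filter, mem_forests] at hF hG
    have sub : ∀ F, IsForest (n - 1) F → ∀ G, IsForest (n - 1) G → F.image φ = G.image φ →
        F ⊆ G := by
      intro F hF G hG h p hp
      have : φ p ∈ G.image φ := h ▸ Finset.mem_image_of_mem φ hp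
      obtain ⟨q, hq, hqp⟩ := Finset.mem_image.1 this
      rwa [← φ_inj G hG F hF q hq p hp hqp]
    exact (sub F hF.1.1 G hG.1.1 h).antisymm (sub G hG.1.1 F hF.1.1 h.symm)
  · intro D hD
    rw [mem_periodicDissections] at hD
    obtain ⟨hD, -, hk⟩ := hD
    set F := (Finset.range n ×ˢ Finset.range n).filter
      (fun p => p.1 + 2 ≤ p.2 ∧ φ p ∈ D) with hFdef
    have memF : ∀ p, p ∈ F ↔ p.2 < n ∧ p.1 + 2 ≤ p.2 ∧ φ p ∈ D := by
      intro p
      simp only [hFdef, Finset.mem_filter, Finset.mem_product, Finset.mem_range]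
      constructor
      · rintro ⟨h1, h2, h3⟩
        exact ⟨by omega, h2, h3⟩
      · rintro ⟨h1, h2, h3⟩
        exact ⟨by omega, h2, h3⟩
    have hF : IsForest (n - 1) F := by
      constructor
      · intro p hp
        have := (memF p).1 hp
        omega
      · rintro p hp q hq ⟨h1, h2, h3⟩
        rw [memF] at hp hq
        exact hD.2 _ hp.2.2 _ hq.2.2 (crosses_vtx (by omega) (by omega) (by omega) (by omega))
    have him : F.image φ = D := by
      ext e
      rw [Finset.mem_image]
      constructor
      · rintro ⟨p, hp, rfl⟩
        exact ((memF p).1 hp).2.2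
      · intro he
        obtain ⟨i, j, h1, h2, h3, h4, rfl⟩ := (hD.1 e he).exists_vtx 0
        have e1 : φ (i.toNat, j.toNat) = s(vtx n i, vtx n j) := by
          simp only [hφ]
          rw [Int.toNat_of_nonneg (by omega), Int.toNat_of_nonneg (by omega)]
        refine ⟨(i.toNat, j.toNat), (memF _).2 ⟨?_, ?_, ?_⟩, e1⟩
        · simp only; omega
        · simp only; omega
        · rwa [e1]
    refine ⟨F, ?_, him⟩
    rw [Finset.mem_filter, mem_forests, hF.one_lt_card_uncovered_iff (by omega)]
    refine ⟨⟨hF, ?_⟩, ?_⟩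
    · rw [← hk, ← him, Finset.card_image_of_injOn]
      intro p hp q hq h
      exact φ_inj F hF F hF p hp q hq h
    · intro h
      have := hD.1 _ ((memF _).1 h).2.2
      simp only [hφ] at this
      rw [isDiagonal_vtx_iff (by omega) (by omega)] at this
      omega

end Counting

/-! ### Orbit counting under the rotation group -/

section Burnside

variable {n : ℕ} [NeZero n]

theorem map_finRotate_zpow_vtx (r i j : ℤ) :
    Sym2.map ⇑(finRotate n ^ r) s(vtx n i, vtx n j) = s(vtx n (i + r), vtx n (j + r)) := by
  rw [Sym2.map_mk, finRotate_zpow_vtx, finRotate_zpow_vtx]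

theorem IsDissection.image_finRotate_zpow {D : Finset (Sym2 (Fin n))} (hD : IsDissection n D)
    (r : ℤ) : IsDissection n (D.image (Sym2.map ⇑(finRotate n ^ r))) := by
  constructor
  · intro e he
    obtain ⟨f, hf, rfl⟩ := Finset.mem_image.1 he
    obtain ⟨i, j, h1, h2, h3, h4, rfl⟩ := (hD.1 f hf).exists_vtx 0
    rw [map_finRotate_zpow_vtx, isDiagonal_vtx_iff (by omega) (by omega)]
    omega
  · intro e he f hf h
    obtain ⟨e, he', rfl⟩ := Finset.mem_image.1 he
    obtain ⟨f, hf', rfl⟩ := Finset.mem_image.1 hf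
    obtain ⟨i, j, h1, h2, h3, rfl⟩ := exists_eq_mk_vtx e 0
    rw [map_finRotate_zpow_vtx] at h
    obtain ⟨x, y, h4, h5, h6, h7, h8⟩ := h.exists_vtx (by omega) (by omega)
    have hfxy : f = s(vtx n (x - r), vtx n (y - r)) := by
      apply Sym2.map.injective (finRotate n ^ r).injective
      rw [h8, map_finRotate_zpow_vtx, sub_add_cancel, sub_add_cancel]
    refine hD.2 _ he' _ hf' ?_
    rw [hfxy]
    exact crosses_vtx (by omega) (by omega) (by omega) (by omega)

theorem image_finRotate_zpow_eq_iff {D : Finset (Sym2 (Fin n))} {r : ℤ} :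
    D.image (Sym2.map ⇑(finRotate n ^ r)) = D ↔ IsPeriodic r D := by
  constructor
  · intro h i j
    rw [← map_finRotate_zpow_vtx]
    conv_rhs => rw [← h]
    exact ((Sym2.map.injective (finRotate n ^ r).injective).mem_finset_image).symm
  · intro h
    ext e
    constructor
    · intro he
      obtain ⟨f, hf, rfl⟩ := Finset.mem_image.1 he
      obtain ⟨i, j, -, -, -, rfl⟩ := exists_eq_mk_vtx f 0
      rw [map_finRotate_zpow_vtx]
      exact (h i j).1 hf
    · intro he
      obtain ⟨i, j, -, -, -, rfl⟩ := exists_eq_mk_vtx e 0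
      refine Finset.mem_image.2 ⟨s(vtx n (i - r), vtx n (j - r)), ?_, ?_⟩
      · rw [h]
        simpa using he
      · rw [map_finRotate_zpow_vtx, sub_add_cancel, sub_add_cancel]

theorem IsPeriodic.add {D : Finset (Sym2 (Fin n))} {r r' : ℤ} (h : IsPeriodic r D)
    (h' : IsPeriodic r' D) : IsPeriodic (r + r') D := by
  intro i j
  rw [h, h', add_assoc, add_assoc]

/-- By Bézout, since `n` is always a period. Thus the dissections fixed by a rotation depend only on
the gcd of its step with `n`. -/
theorem isPeriodic_gcd_iff {D : Finset (Sym2 (Fin n))} {r : ℕ} :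
    IsPeriodic ((n.gcd r : ℕ) : ℤ) D ↔ IsPeriodic r D := by
  constructor
  · intro h
    obtain ⟨c, hc⟩ := Nat.gcd_dvd_right n r
    have := h.mul c
    rw [mul_comm] at this
    rw [hc]
    push_cast
    exact this
  · intro h
    rw [Nat.gcd_eq_gcd_ab, mul_comm (n : ℤ), mul_comm (r : ℤ)]
    exact ((isPeriodic_self D).mul _).add (h.mul _)

theorem orderOf_finRotate {n : ℕ} (hn : 2 ≤ n) : orderOf (finRotate n) = n := by
  rw [(isCycle_finRotate_of_le hn).orderOf, support_finRotate_of_le hn, Finset.card_univ,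
    Fintype.card_fin]

/-- The rotations of the `n`-gon act on its dissections. -/
noncomputable instance dissectionAction (k : ℕ) :
    MulAction (Subgroup.zpowers (finRotate n)) (Dissection n k) where
  smul g D := ⟨D.1.image (Sym2.map ⇑(g : Equiv.Perm (Fin n))), by
    obtain ⟨_, r, rfl⟩ := g
    have := IsDissection.image_finRotate_zpow ⟨D.2.2.1, D.2.2.2⟩ r
    refine ⟨?_, this.1, this.2⟩
    exact (Finset.card_image_of_injective _
      (Sym2.map.injective (finRotate n ^ r).injective)).trans D.2.1⟩
  one_smul D := Subtype.ext (by
    change D.1.image (Sym2.map ⇑(1 : Equiv.Perm (Fin n))) = D.1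
    simp)
  mul_smul g h D := Subtype.ext (by
    change D.1.image (Sym2.map ⇑((g * h : Subgroup.zpowers (finRotate n)) : Equiv.Perm (Fin n))) =
      (D.1.image (Sym2.map ⇑(h : Equiv.Perm (Fin n)))).image (Sym2.map ⇑(g : Equiv.Perm (Fin n)))
    rw [Finset.image_image, ← Sym2.map_comp]
    rfl)

theorem coe_smul_dissection {k : ℕ} (g : Subgroup.zpowers (finRotate n)) (D : Dissection n k) :
    (g • D).1 = D.1.image (Sym2.map ⇑(g : Equiv.Perm (Fin n))) := rfl

instance finite_dissection (k : ℕ) : Finite (Dissection n k) := by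
  unfold Dissection
  infer_instance

theorem rotationSetoid_eq_orbitRel (k : ℕ) :
    rotationSetoid n k = MulAction.orbitRel (Subgroup.zpowers (finRotate n)) (Dissection n k) := by
  ext D E
  rw [MulAction.orbitRel_apply]
  change (∃ r : ℤ, E.1 = D.1.image (Sym2.map ⇑(finRotate n ^ r))) ↔ _
  constructor
  · rintro ⟨r, h⟩
    rw [← MulAction.orbitRel_apply]
    apply Setoid.symm'
    rw [MulAction.orbitRel_apply]
    exact ⟨⟨finRotate n ^ r, r, rfl⟩, Subtype.ext (by simp only [coe_smul_dissection]; exact h.symm)⟩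
  · intro h
    rw [← MulAction.orbitRel_apply] at h
    replace h := Setoid.symm' _ h
    rw [MulAction.orbitRel_apply] at h
    obtain ⟨⟨_, r, rfl⟩, h⟩ := h
    exact ⟨r, by rw [← h]; rfl⟩

theorem card_fixedBy_dissection (k r : ℕ) (g : Subgroup.zpowers (finRotate n))
    (hg : (g : Equiv.Perm (Fin n)) = finRotate n ^ r) :
    Nat.card (MulAction.fixedBy (Dissection n k) g) =
      (periodicDissections n (n.gcd r) k).card := by
  have key : ∀ D : Dissection n k, D ∈ MulAction.fixedBy (Dissection n k) g ↔
      D.1 ∈ periodicDissections n (n.gcd r) k := by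
    intro D
    have hext : g • D = D ↔ (g • D).1 = D.1 := Subtype.ext_iff
    rw [MulAction.mem_fixedBy, hext, coe_smul_dissection, hg, mem_periodicDissections,
      isPeriodic_gcd_iff, ← image_finRotate_zpow_eq_iff, zpow_natCast]
    exact ⟨fun h => ⟨⟨D.2.2.1, D.2.2.2⟩, h, D.2.1⟩, fun h => h.2.1⟩
  rw [← Nat.card_eq_finsetCard]
  refine Nat.card_congr
    { toFun := fun D => ⟨D.1.1, (key D.1).1 D.2⟩
      invFun := fun D =>
        have h := mem_periodicDissections.1 D.2
        ⟨⟨D.1, h.2.2, h.1.1, h.1.2⟩, (key _).2 D.2⟩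
      left_inv := fun _ => rfl
      right_inv := fun _ => rfl }

theorem numCyclicClasses_mul (hn : 2 ≤ n) (k : ℕ) :
    numCyclicClasses n k * n = ∑ r ∈ Finset.range n, (periodicDissections n (n.gcd r) k).card := by
  classical
  have hfin : IsOfFinOrder (finRotate n) := isOfFinOrder_of_finite _
  let : Fintype (Dissection n k) := Fintype.ofFinite _
  let : Fintype (Subgroup.zpowers (finRotate n)) := Fintype.ofFinite _
  let : ∀ g : Subgroup.zpowers (finRotate n), Fintype (MulAction.fixedBy (Dissection n k) g) :=
    fun _ => Fintype.ofFinite _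
  let : Fintype (MulAction.orbitRel.Quotient (Subgroup.zpowers (finRotate n)) (Dissection n k)) :=
    Fintype.ofFinite _
  have h := MulAction.sum_card_fixedBy_eq_card_orbits_mul_card_group
    (Subgroup.zpowers (finRotate n)) (Dissection n k)
  have h1 : Fintype.card (Subgroup.zpowers (finRotate n)) = n := by
    rw [← Nat.card_eq_fintype_card, Nat.card_zpowers, orderOf_finRotate hn]
  have h2 : numCyclicClasses n k = Fintype.card
      (MulAction.orbitRel.Quotient (Subgroup.zpowers (finRotate n)) (Dissection n k)) := by
    rw [numCyclicClasses, rotationSetoid_eq_orbitRel, ← Nat.card_eq_fintype_card]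
  rw [h1, ← h2] at h
  rw [← h, ← (finEquivZPowers hfin).sum_comp, ← Fin.sum_univ_eq_sum_range
    (fun r => (periodicDissections n (n.gcd r) k).card) n]
  refine Fintype.sum_equiv (finCongr (orderOf_finRotate hn)) _ _ fun r => ?_
  rw [← Nat.card_eq_fintype_card]
  exact card_fixedBy_dissection k r _ rfl

end Burnside

/-! ### Evaluation of the Burnside sum -/

/-- Exactly `φ(n / g)` residues have gcd `g` with `n`; the sum is then indexed by the order `d = n /
g` of the rotation. -/
theorem sum_range_gcd (n : ℕ) (hn : 0 < n) (f : ℕ → ℕ) :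
    ∑ r ∈ Finset.range n, f (n.gcd r) = ∑ d ∈ n.divisors, d.totient * f (n / d) := by
  rw [← Finset.sum_fiberwise_of_maps_to (s := Finset.range n) (t := n.divisors) (g := n.gcd)
    (fun r _ => Nat.mem_divisors.2 ⟨Nat.gcd_dvd_left n r, hn.ne'⟩),
    ← Nat.sum_div_divisors n (fun d => d.totient * f (n / d))]
  refine Finset.sum_congr rfl fun g hg => ?_
  have hg' := (Nat.mem_divisors.1 hg).1
  rw [Finset.sum_congr rfl (g := fun _ => f g) (by
    intro r hr
    rw [(Finset.mem_filter.1 hr).2]), Finset.sum_const, smul_eq_mul,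
    Nat.totient_div_of_dvd hg', Nat.div_div_self hg' hn.ne']

theorem catalanRat_natCast (k : ℕ) : catalanRat k = catalan k := by
  simp [catalanRat]

/-- The convention for non-integral indices thereby absorbs the divisibility conditions on `n`. -/
theorem catalanRat_div_sub_of_not_dvd {n d : ℕ} (hd : 0 < d) (h : ¬ d ∣ n) (c : ℕ) :
    catalanRat ((n : ℚ) / d - c) = 0 := by
  rw [catalanRat, if_neg]
  rintro ⟨h1, -⟩
  refine h ?_
  obtain ⟨z, hz⟩ : ∃ z : ℤ, (n : ℚ) / d - c = z := ⟨_, ((Rat.den_eq_one_iff _).1 h1).symm⟩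
  have hd' : (d : ℚ) ≠ 0 := by positivity
  have : (n : ℤ) = d * (z + c) := by
    have : (n : ℚ) = d * (z + c) := by rw [← hz]; field_simp; ring
    exact_mod_cast this
  exact Int.natCast_dvd_natCast.1 ⟨_, this⟩

theorem succ_mul_catalan_cast (k : ℕ) : ((k : ℚ) + 1) * catalan k = k.centralBinom := by
  exact_mod_cast succ_mul_catalan_eq_centralBinom k

/-- Here `n = N + 6`, and the summed ballot formula is used with `t = 1`, `s = N + 3`. Two of its
binomials are cubics in `N`; ratios of neighbouring binomials carry the third, `(2N + 4).choose N`,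
to the Catalan number. -/
theorem card_dissections_codim_three (N : ℕ) :
    ((periodicDissections (N + 6) (N + 6) N).card : ℚ) =
      (N + 3) * (N + 2) ^ 2 * (N + 1) / (24 * (2 * N + 7)) * catalan (N + 4) := by
  rw [card_periodicDissections_self (by omega)]
  have h := (forestCount_formula N).2 1 (N + 3)
  rw [show 1 + (N + 3) + 1 = N + 6 - 1 by omega, show N + 6 - 1 = N + 5 by omega,
    show 1 + (N + 3) + N = 2 * N + 4 by ring] at h
  rw [show N + 6 - 1 = N + 5 by omega]
  have c0 : ∀ a : ℕ, (6 : ℚ) * (a + 3).choose a = (a + 3) * (a + 2) * (a + 1) := by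
    intro a
    have h := Nat.descFactorial_eq_factorial_mul_choose (a + 3) 3
    rw [← Nat.choose_symm_add] at h
    simp only [Nat.descFactorial_succ, Nat.descFactorial_zero, Nat.factorial,
      show a + 3 - 2 = a + 1 by omega, show a + 3 - 1 = a + 2 by omega, Nat.sub_zero] at h
    have h' := congrArg (Nat.cast : ℕ → ℚ) h
    push_cast at h'
    linear_combination -h'
  have c1 := c0 N
  have c2 : (6 : ℚ) * (N + 3 + 1).choose (N + 1) = (N + 4) * (N + 3) * (N + 2) := by
    have := c0 (N + 1)
    rw [show N + 1 + 3 = N + 3 + 1 by ring] at this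
    push_cast at this
    linear_combination this
  have b1 : ((2 * N + 4).choose (N + 1) : ℚ) * (N + 1) = (2 * N + 4).choose N * (N + 4) := by
    have := Nat.choose_succ_right_eq (2 * N + 4) N
    rw [show 2 * N + 4 - N = N + 4 by omega] at this
    exact_mod_cast this
  have b2 : ((N + 2).centralBinom : ℚ) * (N + 2) = (2 * N + 4).choose (N + 1) * (N + 3) := by
    have := Nat.choose_succ_right_eq (2 * N + 4) (N + 1)
    rw [show 2 * N + 4 - (N + 1) = N + 3 by omega] at this
    rw [Nat.centralBinom, show 2 * (N + 2) = 2 * N + 4 by ring]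
    exact_mod_cast this
  have b3 : ((N : ℚ) + 3) * (N + 3).centralBinom = 2 * (2 * N + 5) * (N + 2).centralBinom := by
    have := Nat.succ_mul_centralBinom_succ (N + 2)
    have h' : (((N + 2 + 1) * (N + 2 + 1).centralBinom : ℕ) : ℚ) =
      ((2 * (2 * (N + 2) + 1) * (N + 2).centralBinom : ℕ) : ℚ) := by rw [this]
    push_cast at h'
    linear_combination h'
  have b4 : ((N : ℚ) + 4) * (N + 4).centralBinom = 2 * (2 * N + 7) * (N + 3).centralBinom := by
    have := Nat.succ_mul_centralBinom_succ (N + 3)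
    have h' : (((N + 3 + 1) * (N + 3 + 1).centralBinom : ℕ) : ℚ) =
      ((2 * (2 * (N + 3) + 1) * (N + 3).centralBinom : ℕ) : ℚ) := by rw [this]
    push_cast at h'
    linear_combination h'
  have b5 := succ_mul_catalan_cast (N + 4)
  push_cast at h b5
  set B : ℚ := (forestCountGT (N + 5) 1 N : ℚ)
  set x : ℚ := ((2 * N + 4).choose N : ℚ)
  set x1 : ℚ := ((2 * N + 4).choose (N + 1) : ℚ)
  set y2 : ℚ := ((N + 2).centralBinom : ℚ)
  set y3 : ℚ := ((N + 3).centralBinom : ℚ)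
  set y4 : ℚ := ((N + 4).centralBinom : ℚ)
  have e1 : x1 = x * (N + 4) / (N + 1) := by field_simp; linear_combination b1
  have e2 : y2 = x1 * (N + 3) / (N + 2) := by field_simp; linear_combination b2
  have e3 : y3 = 2 * (2 * N + 5) * y2 / (N + 3) := by field_simp; linear_combination b3
  have e4 : y4 = 2 * (2 * N + 7) * y3 / (N + 4) := by field_simp; linear_combination b4
  have e5 : (catalan (N + 4) : ℚ) = y4 / (N + 5) := by field_simp; linear_combination b5
  have e6 : B = x * ((N + 3).choose N + (N + 3 + 1).choose (N + 1)) / (N + 5) := by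
    field_simp; linear_combination h
  have e7 : ((N + 3).choose N : ℚ) = (N + 3) * (N + 2) * (N + 1) / 6 := by linear_combination c1 / 6
  have e8 : ((N + 3 + 1).choose (N + 1) : ℚ) = (N + 4) * (N + 3) * (N + 2) / 6 := by
    linear_combination c2 / 6
  rw [e6, e7, e8, e5, e4, e3, e2, e1]
  field_simp
  ring

theorem card_dissections_half_turn (M : ℕ) :
    ((periodicDissections (2 * (M + 3)) (M + 3) (2 * M)).card : ℚ) =
      (M + 1) ^ 2 * catalan (M + 1) := by
  rw [card_periodicDissections (d := 2) rfl le_rfl (by omega) M (fun _ => even_two_mul M), if_pos rfl]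
  -- Threshold `1` excludes the diameter, and `s = M + 1` makes the window length `M + 3`.
  have h := forestWeight_formula 1 (M + 1) M
  rw [show 1 + (M + 1) + 1 = M + 3 by ring, show 1 + (M + 1) + M = 2 * (M + 1) by ring] at h
  rw [h, Nat.choose_succ_self_right]
  have b1 : ((M + 1).centralBinom : ℚ) * (M + 1) = (2 * (M + 1)).choose M * (M + 2) := by
    have := Nat.choose_succ_right_eq (2 * (M + 1)) M
    rw [show 2 * (M + 1) - M = M + 2 by omega] at this
    rw [Nat.centralBinom]
    exact_mod_cast this
  have b2 := succ_mul_catalan_cast (M + 1)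
  push_cast at b2 ⊢
  have hM : (M : ℚ) + 2 ≠ 0 := by positivity
  apply mul_left_cancel₀ hM
  linear_combination -((M : ℚ) + 1) * b1 - ((M : ℚ) + 1) ^ 2 * b2

theorem card_dissections_third_turn (K : ℕ) :
    ((periodicDissections (3 * (K + 2)) (K + 2) (3 * K)).card : ℚ) =
      (K + 1) * (K + 2) / 2 * catalan (K + 1) := by
  rw [card_periodicDissections (d := 3) rfl (by norm_num) (by norm_num) K (by norm_num),
    if_neg (by norm_num)]
  have h := forestWeight_formula 0 (K + 1) K
  rw [show 0 + (K + 1) + 1 = K + 2 by ring, show 0 + (K + 1) + K = 2 * K + 1 by ring] at h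
  rw [h, Nat.choose_succ_self_right]
  have b1 : ((K + 1).centralBinom : ℚ) = 2 * (2 * K + 1).choose K := by
    rw [Nat.centralBinom, show 2 * (K + 1) = 2 * K + 1 + 1 by ring, Nat.choose_succ_succ,
      Nat.choose_symm_half]
    push_cast
    ring
  have b2 := succ_mul_catalan_cast (K + 1)
  push_cast at b2 ⊢
  linear_combination -((K : ℚ) + 1) / 2 * b1 - ((K : ℚ) + 1) / 2 * b2

theorem card_dissections_sixth_turn (K : ℕ) :
    ((periodicDissections (6 * (K + 1)) (K + 1) (6 * K)).card : ℚ) = (K + 1) * catalan K := by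
  rw [card_periodicDissections (d := 6) rfl (by norm_num) (by norm_num) K (by norm_num),
    if_neg (by norm_num)]
  have h := forestWeight_formula 0 K K
  rw [show 0 + K + 1 = K + 1 by ring, show 0 + K + K = 2 * K by ring] at h
  rw [h, Nat.choose_self, succ_mul_catalan_cast, Nat.centralBinom]
  simp

theorem sum_divisors_eq_sum_divisors_six {n : ℕ} (hn : 0 < n) (f : ℕ → ℚ)
    (hf : ∀ d ∈ n.divisors, ¬ d ∣ 6 → f d = 0) :
    ∑ d ∈ n.divisors, f d = f 1 + (if 2 ∣ n then f 2 else 0) + (if 3 ∣ n then f 3 else 0) +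
      (if 6 ∣ n then f 6 else 0) := by
  have h6 : (6 : ℕ).divisors = {1, 2, 3, 6} := by decide
  have h1 : ∑ d ∈ n.divisors, f d = ∑ d ∈ (6 : ℕ).divisors, if d ∣ n then f d else 0 := by
    rw [← Finset.sum_filter, ← Finset.sum_filter_of_ne (p := fun d => d ∣ 6)]
    · refine Finset.sum_congr ?_ fun _ _ => rfl
      ext d
      simp only [Finset.mem_filter, Nat.mem_divisors]
      have := hn.ne'
      tauto
    · intro d hd h
      by_contra hc
      exact h (hf d hd hc)
  rw [h1, h6]
  simp [add_assoc]

theorem theorem4 (n : ℕ) (hn : 6 ≤ n) :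
    (numCyclicClasses n (n - 6) : ℚ) =
      ((n : ℚ) - 3) * ((n : ℚ) - 4) ^ 2 * ((n : ℚ) - 5) / (24 * (n : ℚ) * (2 * (n : ℚ) - 5))
          * catalanRat ((n : ℚ) - 2)
        + ((n : ℚ) - 4) ^ 2 / (4 * (n : ℚ)) * catalanRat ((n : ℚ) / 2 - 2)
        + ((n : ℚ) - 3) / 9 * catalanRat ((n : ℚ) / 3 - 1)
        + 1 / 3 * catalanRat ((n : ℚ) / 6 - 1) := by
  have : NeZero n := ⟨by omega⟩
  have hn0 : (n : ℚ) ≠ 0 := NeZero.ne _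
  have h := numCyclicClasses_mul (n := n) (by omega) (n - 6)
  rw [sum_range_gcd n (by omega) fun g => (periodicDissections n g (n - 6)).card] at h
  replace h := congrArg (Nat.cast : ℕ → ℚ) h
  rw [Nat.cast_mul, Nat.cast_sum, sum_divisors_eq_sum_divisors_six (by omega)] at h
  · have h1 : ((Nat.totient 1 * (periodicDissections n (n / 1) (n - 6)).card : ℕ) : ℚ) =
        ((n : ℚ) - 3) * ((n : ℚ) - 4) ^ 2 * ((n : ℚ) - 5) / (24 * (2 * (n : ℚ) - 5)) *
          catalanRat ((n : ℚ) - 2) := by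
      obtain ⟨N, rfl⟩ : ∃ N, n = N + 6 := ⟨n - 6, by omega⟩
      rw [Nat.totient_one, one_mul, Nat.div_one, Nat.add_sub_cancel, card_dissections_codim_three,
        show ((N + 6 : ℕ) : ℚ) - 2 = (N + 4 : ℕ) by push_cast; ring, catalanRat_natCast]
      push_cast
      ring_nf
    have h2 : (if 2 ∣ n then
        ((Nat.totient 2 * (periodicDissections n (n / 2) (n - 6)).card : ℕ) : ℚ) else 0) =
        ((n : ℚ) - 4) ^ 2 / 4 * catalanRat ((n : ℚ) / 2 - 2) := by
      split_ifs with h2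
      · obtain ⟨M, rfl⟩ : ∃ M, n = 2 * (M + 3) := by
          obtain ⟨m, rfl⟩ := h2
          exact ⟨m - 3, by omega⟩
        rw [show 2 * (M + 3) / 2 = M + 3 by omega, show 2 * (M + 3) - 6 = 2 * M by omega,
          Nat.cast_mul, card_dissections_half_turn, Nat.totient_two,
          show ((2 * (M + 3) : ℕ) : ℚ) / 2 - 2 = (M + 1 : ℕ) by push_cast; ring,
          catalanRat_natCast]
        push_cast
        ring
      · have := catalanRat_div_sub_of_not_dvd two_pos h2 2
        push_cast at this
        rw [this, mul_zero]
    have h3 : (if 3 ∣ n then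
        ((Nat.totient 3 * (periodicDissections n (n / 3) (n - 6)).card : ℕ) : ℚ) else 0) =
        (n : ℚ) * ((n : ℚ) - 3) / 9 * catalanRat ((n : ℚ) / 3 - 1) := by
      split_ifs with h3
      · obtain ⟨K, rfl⟩ : ∃ K, n = 3 * (K + 2) := by
          obtain ⟨m, rfl⟩ := h3
          exact ⟨m - 2, by omega⟩
        rw [show 3 * (K + 2) / 3 = K + 2 by omega, show 3 * (K + 2) - 6 = 3 * K by omega,
          Nat.cast_mul, card_dissections_third_turn, Nat.totient_prime Nat.prime_three,
          show ((3 * (K + 2) : ℕ) : ℚ) / 3 - 1 = (K + 1 : ℕ) by push_cast; ring,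
          catalanRat_natCast]
        push_cast
        ring
      · have := catalanRat_div_sub_of_not_dvd three_pos h3 1
        push_cast at this
        rw [this, mul_zero]
    have h6 : (if 6 ∣ n then
        ((Nat.totient 6 * (periodicDissections n (n / 6) (n - 6)).card : ℕ) : ℚ) else 0) =
        (n : ℚ) / 3 * catalanRat ((n : ℚ) / 6 - 1) := by
      split_ifs with h6
      · obtain ⟨K, rfl⟩ : ∃ K, n = 6 * (K + 1) := by
          obtain ⟨m, rfl⟩ := h6
          exact ⟨m - 1, by omega⟩
        rw [show 6 * (K + 1) / 6 = K + 1 by omega, show 6 * (K + 1) - 6 = 6 * K by omega,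
          Nat.cast_mul, card_dissections_sixth_turn, show Nat.totient 6 = 2 by decide,
          show ((6 * (K + 1) : ℕ) : ℚ) / 6 - 1 = (K : ℕ) by push_cast; ring,
          catalanRat_natCast]
        push_cast
        ring
      · have := catalanRat_div_sub_of_not_dvd (show 0 < 6 by norm_num) h6 1
        push_cast at this
        rw [this, mul_zero]
    rw [h1, h2, h3, h6] at h
    rw [← mul_left_inj' hn0, h]
    have h5 : 2 * (n : ℚ) - 5 ≠ 0 := by
      have : (6 : ℚ) ≤ n := by exact_mod_cast hn
      linarith
    field_simp
  -- For other `d`, necessarily at least `3`, symmetry makes the number of diagonals divisible by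
  -- `d`; but `d ∣ n` and `d ∣ n - 6` would give `d ∣ 6`.
  · intro d hd hd6
    have hdn := (Nat.mem_divisors.1 hd).1
    have hd3 : 3 ≤ d := by
      by_contra hc
      interval_cases d
      · simp at hd
      · exact hd6 (one_dvd 6)
      · exact hd6 ⟨3, rfl⟩
    rw [periodicDissections_eq_empty (d := d) (Nat.mul_div_cancel' hdn).symm hd3]
    · simp
    · intro hc
      exact hd6 ((Nat.dvd_sub_iff_right hn hdn).1 hc)
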